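/- Let $\mathbb F\in\{\mathbb R,\mathbb C,\mathbb H\}$, let $1\le q<p$ be integers, and let $K$ be $SO(q)\times SO(p)$, $S(U(q)\times U(p))$, $Sp(q)\times Sp(p)$ for $\mathbb F=\mathbb R,\mathbb C,\mathbb H$ respectively, regarded as the group of block diagonal matrices $k=\begin{pmatrix}u&0\\0&v\end{pmatrix}$ with $u\in U(q,\mathbb F)$, $v\in U(p,\mathbb F)$; this is the maximal compact subgroup of $G=SO_0(q,p)$, $SU(q,p)$, $Sp(q,p)$, and $G/K$ is the non-compact Grassmannian $\mathcal G_{p,q}(\mathbb F)$. Let $dk$ be the normalized Haar measure of $K$. Let $\mathfrak g$ be the Lie algebra of $G$, put $\sigma_0=\begin{pmatrix}I_q\\0\end{pmatrix}\in M_{p,q}(\mathbb F)$, and for $t\in\mathbb R^q$ write $\underline t=\mathrm{diag}(t_1,\dots,t_q)$, $\cosh\underline t=\mathrm{diag}(\cosh t_1,\dots,\cosh t_q)$, $\sinh\underline t=\mathrm{diag}(\sinh t_1,\dots,\sinh t_q)$ and $$H_t=\begin{pmatrix}0&\underline t\,\sigma_0^*\\ \sigma_0\,\underline t&0\end{pmatrix},\qquad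 a_t=\exp(H_t),\qquad \mathfrak a=\{H_t:t\in\mathbb R^q\}\subset\mathfrak g .$$ Let $f_i(H_t)=t_i$. For the positive roots $\alpha\in\Sigma_+=\{f_i,2f_i:1\le i\le q\}\cup\{f_i\pm f_j:1\le i<j\le q\}$ let $\mathfrak g_\alpha=\{X\in\mathfrak g:[H,X]=\alpha(H)X\ \forall H\in\mathfrak a\}$ and $m_\alpha=\dim_{\mathbb R}\mathfrak g_\alpha$ (so $m_{2f_i}=0$ if $\mathbb F=\mathbb R$), and put $\rho^{BC}=\frac12\sum_{\alpha\in\Sigma_+}m_\alpha\alpha$, $\mathfrak n=\sum_{\alpha\in\Sigma_+}\mathfrak g_\alpha$, $N=\exp\mathfrak n$. With $A=\exp\mathfrak a$ and the Iwasawa decomposition $G=KAN$, let $H(g)\in\mathfrak a$ be the unique element with $g\in K\exp(H(g))N$. Identify $\mathfrak a_{\mathbb C}^*$ with $\mathbb C^q$ by $\lambda(H_t)=\sum_{r}\lambda_rt_r$, and let the spherical functions be given by the Harish-Chandra integral $$\varphi_\lambda^p(g)=\int_K e^{(i\lambda-\rho^{BC})(H(gk))}\,dk .$$ For a square matrix $x$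 over $\mathbb F$ let $\Delta_r(x)$ be the determinant of its upper left $r\times r$ block (for $\mathbb F=\mathbb H$ the Dieudonné determinant, that is, the square root of the determinant of the associated complex $2r\times 2r$ matrix). For $\mu\in\mathbb C^q$ and $x$ in the cone $\Omega_q$ of Hermitian strictly positive definite $q\times q$ matrices over $\mathbb F$, put $$\Delta_\mu(x)=\Delta_1(x)^{\mu_1-\mu_2}\cdots\Delta_{q-1}(x)^{\mu_{q-1}-\mu_q}\,\Delta_q(x)^{\mu_q}.$$ **Theorem.** For all $\lambda\in\mathbb C^q$ and $t\in\mathbb R^q$, $$\varphi_\lambda^p(a_t)=\int_K\Delta_{(i\lambda-\rho^{BC})/2}(x_t(k))\,dk,$$ where, for $k=\begin{pmatrix}u&0\\0&v\end{pmatrix}\in K$, $$x_t(k)=(\cosh\underline t\,u+\sinh\underline t\,\sigma_0^*v\sigma_0)^*(\cosh\underline t\,u+\sinh\underline t\,\sigma_0^*v\sigma_0)\in\Omega_q .$$ Here $H(a_tk)$ is well defined for all $k\in K$, and both integrands are integrable over $K$. -/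

import Mathlib

open scoped Matrix Quaternion

noncomputable section

namespace Grassmannian

/-! ### Matrices over the three scalar fields -/

/-- The complex `2n × 2n` matrix attached to a quaternionic `n × n` matrix `A = A₁ + A₂ j`
(with `A₁`, `A₂` complex), namely the block matrix with rows `(A₁, A₂)` and
`(-conj A₂, conj A₁)`. -/
def quatToComplex {n : Type} (A : Matrix n n ℍ[ℝ]) : Matrix (n ⊕ n) (n ⊕ n) ℂ :=
  Matrix.fromBlocks
    (Matrix.of fun i j => (⟨(A i j).re, (A i j).imI⟩ : ℂ))
    (Matrix.of fun i j => (⟨(A i j).imJ, (A i j).imK⟩ : ℂ))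
    (Matrix.of fun i j => -(starRingEnd ℂ) (⟨(A i j).imJ, (A i j).imK⟩ : ℂ))
    (Matrix.of fun i j => (starRingEnd ℂ) (⟨(A i j).re, (A i j).imI⟩ : ℂ))

/-- The unitary group `U(n, F) = {X : X* X = X X* = 1}` of `n × n` matrices over `F`. -/
abbrev U (n : ℕ) (F : Type) [NormedDivisionRing F] [StarRing F] : Type :=
  unitary (Matrix (Fin n) (Fin n) F)

/-- In `U(n, F)` the entries of a matrix have norm at most `1`, if `star a * a = ‖a‖²` in `F`; so
`U(n, F)` is compact if `F` is moreover locally compact. -/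
theorem compactSpace_U (n : ℕ) (F : Type) [NormedDivisionRing F] [NormedAlgebra ℝ F]
    [StarRing F] [ContinuousStar F] [ProperSpace F]
    (hF : ∀ a : F, star a * a = algebraMap ℝ F (‖a‖ ^ 2)) : CompactSpace (U n F) := by
  refine isCompact_iff_compactSpace.mp ?_
  have hb : IsCompact {A : Matrix (Fin n) (Fin n) F | ∀ i j, A i j ∈ Metric.closedBall 0 1} := by
    have h1 : IsCompact {v : Fin n → F | ∀ j, v j ∈ Metric.closedBall 0 1} :=
      isCompact_pi_infinite fun _ => isCompact_closedBall 0 1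
    exact isCompact_pi_infinite (X := fun _ : Fin n => Fin n → F) fun _ => h1
  refine hb.of_isClosed_subset ?_ ?_
  · have : ((unitary (Matrix (Fin n) (Fin n) F) : Submonoid _) : Set (Matrix (Fin n) (Fin n) F)) =
        {A | star A * A = 1} ∩ {A | A * star A = 1} := by
      ext A; rfl
    rw [this]
    exact (isClosed_eq (by fun_prop) continuous_const).inter
      (isClosed_eq (by fun_prop) continuous_const)
  · intro A hA i j
    have h1 : (star A * A) j j = 1 := by
      rw [Unitary.star_mul_self_of_mem hA, Matrix.one_apply_eq]
    rw [Matrix.mul_apply] at h1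
    simp only [Matrix.star_apply, hF] at h1
    rw [← map_sum, ← map_one (algebraMap ℝ F)] at h1
    have h2 := (algebraMap ℝ F).injective h1
    have h3 : ‖A i j‖ ^ 2 ≤ 1 := by
      rw [← h2]
      exact Finset.single_le_sum (f := fun k => ‖A k j‖ ^ 2) (fun k _ => sq_nonneg _)
        (Finset.mem_univ i)
    rw [mem_closedBall_zero_iff]
    nlinarith [norm_nonneg (A i j)]

/-- The data in which `F = ℝ, ℂ, ℍ` differ. There are exactly the three instances given below. -/
class Scalars (F : Type) [NormedDivisionRing F] [NormedAlgebra ℝ F] [StarRing F] where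
  /-- The determinant: the usual one for `ℝ` and `ℂ`, the Dieudonné determinant for `ℍ`. -/
  det : ∀ {n : Type} [Fintype n] [DecidableEq n], Matrix n n F → ℂ
  /-- The projection of `F` along its commutators: the identity for `ℝ` and `ℂ`, the real
  part for `ℍ`. -/
  redTrace : F →ₗ[ℝ] F
  /-- The group of all `(u, v)` such that the block diagonal matrix `diag(u, v)` is in the
  maximal compact subgroup `K`, which is `SO(q) × SO(p)`, `S(U(q) × U(p))`, `Sp(q) × Sp(p)`,
  respectively. -/
  K : ∀ q p : ℕ, Subgroup (U q F × U p F)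
  isCompact_K : ∀ q p : ℕ, IsCompact (K q p : Set (U q F × U p F))

instance : Scalars ℝ where
  det A := (A.det : ℂ)
  redTrace := LinearMap.id
  K q p :=
    { carrier := {k | (k.1 : Matrix (Fin q) (Fin q) ℝ).det = 1 ∧
        (k.2 : Matrix (Fin p) (Fin p) ℝ).det = 1}
      one_mem' := by simp
      mul_mem' := by
        rintro a b ⟨h1, h2⟩ ⟨h3, h4⟩
        simp [Matrix.det_mul, h1, h2, h3, h4]
      inv_mem' := by
        rintro a ⟨h1, h2⟩
        simp [← Unitary.star_eq_inv, Matrix.star_eq_conjTranspose, h1, h2] }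
  isCompact_K q p := by
    have := compactSpace_U q ℝ fun a => by simp [sq]
    have := compactSpace_U p ℝ fun a => by simp [sq]
    exact ((isClosed_eq (by fun_prop) continuous_const).inter
      (isClosed_eq (by fun_prop) continuous_const)).isCompact

instance : Scalars ℂ where
  det A := A.det
  redTrace := LinearMap.id
  K q p :=
    { carrier := {k | (k.1 : Matrix (Fin q) (Fin q) ℂ).det *
        (k.2 : Matrix (Fin p) (Fin p) ℂ).det = 1}
      one_mem' := by simp
      mul_mem' := by
        intro a b h1 h2
        simp only [Set.mem_ofPred_eq, Prod.fst_mul, Prod.snd_mul, Submonoid.coe_mul,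
          Matrix.det_mul] at *
        rw [mul_mul_mul_comm, h1, h2, one_mul]
      inv_mem' := by
        intro a h1
        simp only [Set.mem_ofPred_eq, Prod.fst_inv, Prod.snd_inv, ← Unitary.star_eq_inv,
          Unitary.coe_star, Matrix.star_eq_conjTranspose, Matrix.det_conjTranspose] at *
        rw [← star_mul', h1, star_one] }
  isCompact_K q p := by
    have hC : ∀ a : ℂ, star a * a = algebraMap ℝ ℂ (‖a‖ ^ 2) := fun a => by
      simpa using Complex.conj_mul' a
    have := compactSpace_U q ℂ hC
    have := compactSpace_U p ℂ hC
    exact (isClosed_eq (by fun_prop) continuous_const).isCompact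

instance : Scalars ℍ[ℝ] where
  det A := (quatToComplex A).det ^ (1 / 2 : ℂ)
  redTrace :=
    { toFun := fun x => (x.re : ℍ[ℝ])
      map_add' := fun x y => by simp
      map_smul' := fun c x => by ext <;> simp }
  K _ _ := ⊤
  isCompact_K q p := by
    have hH : ∀ a : ℍ[ℝ], star a * a = algebraMap ℝ ℍ[ℝ] (‖a‖ ^ 2) := fun a => by
      rw [Quaternion.star_mul_self, Quaternion.normSq_eq_norm_mul_self, sq]
      rfl
    have : ProperSpace ℍ[ℝ] := FiniteDimensional.proper ℝ ℍ[ℝ]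
    have := compactSpace_U q ℍ[ℝ] hH
    have := compactSpace_U p ℍ[ℝ] hH
    exact isCompact_univ

instance : StarModule ℝ ℍ[ℝ] := ⟨fun c x => by ext <;> simp⟩

/-! ### The group `K` and its normalized Haar measure -/

section Definitions

variable (F : Type) [NormedDivisionRing F] [NormedAlgebra ℝ F] [StarRing F] [Scalars F]
variable {q p : ℕ}

/-- `(q + p) × (q + p)` matrices over `F` in `(q, p)`-block form. -/
abbrev Mat (q p : ℕ) : Type := Matrix (Fin q ⊕ Fin p) (Fin q ⊕ Fin p) F

/-- The maximal compact subgroup `K`, as a group of pairs `(u, v)`. -/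
abbrev K (q p : ℕ) : Type := Scalars.K (F := F) q p

variable {F} in
/-- The block diagonal matrix `diag(u, v)` of an element `(u, v)` of `K`. -/
def K.toMat (k : K F q p) : Mat F q p :=
  Matrix.fromBlocks (k.1.1 : Matrix (Fin q) (Fin q) F) 0 0 (k.1.2 : Matrix (Fin p) (Fin p) F)

instance : CompactSpace (K F q p) :=
  isCompact_iff_compactSpace.mp (Scalars.isCompact_K q p)

instance : MeasurableSpace (K F q p) := borel _

instance : BorelSpace (K F q p) := ⟨rfl⟩

/-- The Haar measure `dk` of `K`, normalized to total mass `1`. -/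
def haarK (q p : ℕ) [ContinuousStar F] : MeasureTheory.Measure (K F q p) :=
  MeasureTheory.Measure.haarMeasure ⊤

/-! ### Lie algebra, restricted roots and Iwasawa projection -/

/-- The matrix `σ₀ ∈ M_{p,q}(F)`, with the identity on top and zeros below. -/
def sigma0 (q p : ℕ) : Matrix (Fin p) (Fin q) F :=
  Matrix.of fun i j => if i.val = j.val then 1 else 0

/-- The real diagonal matrix `diag(s₁, …, s_q)` with entries regarded in `F`. -/
def diagReal (s : Fin q → ℝ) : Matrix (Fin q) (Fin q) F :=
  Matrix.diagonal fun i => algebraMap ℝ F (s i)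

/-- The element `H_t` of `𝔞`, with off-diagonal blocks `(diag t, 0)` and its transpose. -/
def H (p : ℕ) (t : Fin q → ℝ) : Mat F q p :=
  Matrix.fromBlocks 0 (diagReal F t * (sigma0 F q p)ᴴ) (sigma0 F q p * diagReal F t) 0

section LieAlgebra

variable [StarModule ℝ F]

/-- The Lie algebra `𝔤` of `SO₀(q,p)`, `SU(q,p)`, `Sp(q,p)`: block matrices with rows `(A, B)` and
`(B*, D)`, with `A`, `D` skew-Hermitian and `tr A + tr D = 0`, where for `ℍ` the trace is the
reduced one (so that there the trace condition is void). -/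
def lieAlg (q p : ℕ) : Submodule ℝ (Mat F q p) where
  carrier := {X | X.toBlocks₁₁ᴴ = -X.toBlocks₁₁ ∧ X.toBlocks₂₂ᴴ = -X.toBlocks₂₂ ∧
    X.toBlocks₂₁ = X.toBlocks₁₂ᴴ ∧
    Scalars.redTrace (X.toBlocks₁₁.trace + X.toBlocks₂₂.trace) = 0}
  zero_mem' := by
    refine ⟨?_, ?_, ?_, ?_⟩
    · ext; simp [Matrix.toBlocks₁₁]
    · ext; simp [Matrix.toBlocks₂₂]
    · ext; simp [Matrix.toBlocks₁₂, Matrix.toBlocks₂₁]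
    · simp [Matrix.trace, Matrix.toBlocks₁₁, Matrix.toBlocks₂₂]
  add_mem' := by
    rintro X Y ⟨h1, h2, h3, h4⟩ ⟨h1', h2', h3', h4'⟩
    refine ⟨?_, ?_, ?_, ?_⟩
    · change (X.toBlocks₁₁ + Y.toBlocks₁₁)ᴴ = -(X.toBlocks₁₁ + Y.toBlocks₁₁)
      rw [Matrix.conjTranspose_add, h1, h1', neg_add]
    · change (X.toBlocks₂₂ + Y.toBlocks₂₂)ᴴ = -(X.toBlocks₂₂ + Y.toBlocks₂₂)
      rw [Matrix.conjTranspose_add, h2, h2', neg_add]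
    · change X.toBlocks₂₁ + Y.toBlocks₂₁ = (X.toBlocks₁₂ + Y.toBlocks₁₂)ᴴ
      rw [Matrix.conjTranspose_add, h3, h3']
    · change Scalars.redTrace ((X.toBlocks₁₁ + Y.toBlocks₁₁).trace +
        (X.toBlocks₂₂ + Y.toBlocks₂₂).trace) = 0
      rw [Matrix.trace_add, Matrix.trace_add, add_add_add_comm, map_add, h4, h4', add_zero]
  smul_mem' := by
    rintro c X ⟨h1, h2, h3, h4⟩
    refine ⟨?_, ?_, ?_, ?_⟩
    · change (c • X.toBlocks₁₁)ᴴ = -(c • X.toBlocks₁₁)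
      rw [Matrix.conjTranspose_smul, h1, star_trivial, smul_neg]
    · change (c • X.toBlocks₂₂)ᴴ = -(c • X.toBlocks₂₂)
      rw [Matrix.conjTranspose_smul, h2, star_trivial, smul_neg]
    · change c • X.toBlocks₂₁ = (c • X.toBlocks₁₂)ᴴ
      rw [Matrix.conjTranspose_smul, h3, star_trivial]
    · change Scalars.redTrace ((c • X.toBlocks₁₁).trace + (c • X.toBlocks₂₂).trace) = 0
      rw [Matrix.trace_smul, Matrix.trace_smul, ← smul_add, map_smul, h4, smul_zero]

/-- The root space `𝔤_α = {X ∈ 𝔤 : [H_s, X] = α(H_s) X for all s}` of the functional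
`α = ∑ αᵢ fᵢ`, where `fᵢ(H_s) = sᵢ`. -/
def rootSpace (q p : ℕ) (α : Fin q → ℝ) : Submodule ℝ (Mat F q p) :=
  lieAlg F q p ⊓
    { carrier := {X | ∀ s : Fin q → ℝ, H F p s * X - X * H F p s = (∑ i, α i * s i) • X}
      zero_mem' := fun s => by simp
      add_mem' := fun {X Y} hX hY s => by
        rw [mul_add, add_mul, add_sub_add_comm, hX s, hY s, smul_add]
      smul_mem' := fun c X hX s => by
        rw [Matrix.mul_smul, Matrix.smul_mul, ← smul_sub, hX s, smul_comm] }

open Classical in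
/-- The positive roots `fᵢ`, `2fᵢ` and `fᵢ ± fⱼ` with `i < j`, in the basis `f₁, …, f_q`. (For
`F = ℝ` the functionals `2fᵢ` have multiplicity `0`.) -/
def posRoots (q : ℕ) : Finset (Fin q → ℝ) :=
  Finset.univ.image (fun i => Pi.single i 1) ∪
  Finset.univ.image (fun i => Pi.single i 2) ∪
  {x : Fin q × Fin q | x.1 < x.2}.toFinset.image (fun x => Pi.single x.1 1 - Pi.single x.2 1) ∪
  {x : Fin q × Fin q | x.1 < x.2}.toFinset.image (fun x => Pi.single x.1 1 + Pi.single x.2 1)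

/-- The weighted half sum `ρ^BC = ½ ∑_{α > 0} m_α α`, with multiplicities `m_α = dim_ℝ 𝔤_α`. -/
def rhoBC (q p : ℕ) : Fin q → ℝ :=
  (1 / 2 : ℝ) • ∑ α ∈ posRoots q, (Module.finrank ℝ (rootSpace F q p α) : ℝ) • α

/-- `𝔫`, the sum of the positive root spaces. -/
def nilAlg (q p : ℕ) : Submodule ℝ (Mat F q p) :=
  ⨆ α ∈ posRoots q, rootSpace F q p α

/-- `N = exp 𝔫`. -/
def N (q p : ℕ) : Set (Mat F q p) := NormedSpace.exp '' (nilAlg F q p : Set (Mat F q p))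

/-- `a_t = exp H_t`. -/
def a (p : ℕ) (t : Fin q → ℝ) : Mat F q p := NormedSpace.exp (H F p t)

variable {F} in
/-- `a_s` is the abelian part of `g` in the Iwasawa decomposition: `g ∈ K a_s N`. -/
def IsAbelianPart (g : Mat F q p) (s : Fin q → ℝ) : Prop :=
  ∃ k : K F q p, ∃ n ∈ N F q p, g = k.toMat * a F p s * n

variable {F} in
/-- The Iwasawa projection `H(g) ∈ 𝔞 ≅ ℝ^q` of `g ∈ G = K A N`, so that
`g ∈ K exp(H(g)) N`. -/
def iwasawaH (g : Mat F q p) : Fin q → ℝ := Classical.epsilon (IsAbelianPart g)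

/-- The integrand `e^{(iλ - ρ)(H(g k))}`. -/
def hcIntegrand (lam : Fin q → ℂ) (g : Mat F q p) (k : K F q p) : ℂ :=
  Complex.exp (∑ r, (Complex.I * lam r - (rhoBC F q p r : ℂ)) *
    (iwasawaH (g * k.toMat) r : ℂ))

variable [ContinuousStar F]

/-- The spherical function `φ_λ^p(g) = ∫_K e^{(iλ - ρ)(H(g k))} dk` of `G / K`, by the
Harish-Chandra integral. -/
def spherical (lam : Fin q → ℂ) (g : Mat F q p) : ℂ :=
  ∫ k, hcIntegrand F lam g k ∂(haarK F q p)

end LieAlgebra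

/-! ### The power function on the cone of positive definite matrices -/

variable {F}

/-- `Ω_q`, the cone of Hermitian, strictly positive definite matrices over `F`. -/
def Omega (F : Type) [NormedDivisionRing F] [NormedAlgebra ℝ F] [StarRing F] (q : ℕ) :
    Set (Matrix (Fin q) (Fin q) F) :=
  {x | xᴴ = x ∧ ∀ v : Fin q → F, v ≠ 0 →
    ∃ c : ℝ, 0 < c ∧ star v ⬝ᵥ (x *ᵥ v) = algebraMap ℝ F c}

/-- The principal minor of size `r.val + 1`: the determinant of the upper left block. -/
def minor (x : Matrix (Fin q) (Fin q) F) (r : Fin q) : ℂ :=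
  Scalars.det (x.submatrix (Fin.castLE r.isLt) (Fin.castLE r.isLt) :
    Matrix (Fin (r.val + 1)) (Fin (r.val + 1)) F)

/-- The power function
`Δ_μ(x) = Δ₁(x)^(μ₁-μ₂) ⋯ Δ_{q-1}(x)^(μ_{q-1}-μ_q) Δ_q(x)^(μ_q)` (on `Ω_q`). -/
def powerFun (mu : Fin q → ℂ) (x : Matrix (Fin q) (Fin q) F) : ℂ :=
  ∏ r : Fin q, minor x r ^
    (mu r - if h : r.val + 1 < q then mu ⟨r.val + 1, h⟩ else 0)

/-- `cosh t · u + sinh t · σ₀* v σ₀` for `k = diag(u, v)`. -/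
def y (t : Fin q → ℝ) (k : K F q p) : Matrix (Fin q) (Fin q) F :=
  diagReal F (fun i => Real.cosh (t i)) * (k.1.1 : Matrix (Fin q) (Fin q) F) +
    diagReal F (fun i => Real.sinh (t i)) *
      ((sigma0 F q p)ᴴ * (k.1.2 : Matrix (Fin p) (Fin p) F) * sigma0 F q p)

/-- `x_t(k) = (cosh t · u + sinh t · σ₀* v σ₀)* (cosh t · u + sinh t · σ₀* v σ₀)`. -/
def x (t : Fin q → ℝ) (k : K F q p) : Matrix (Fin q) (Fin q) F := (y t k)ᴴ * y t k

end Definitions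

end Grassmannian

end

open scoped Matrix Quaternion

set_option linter.unusedSectionVars false

noncomputable section

namespace Grassmannian

/-! The two integrands agree at every point of `K`; no change of variables is involved. Write `a_t k
= k' a_s n` with `k' = diag(u', v')`, so that `s` is the Iwasawa projection of `a_t k`. The columns
of `(I; σ₀)/√2` are common eigenvectors of `𝔞` with weights `f₁, …, f_q`, the highest ones, and `N`
acts on their span by unipotent upper triangular matrices. Applying both sides to these columns and
keeping the first `q` rows gives `cosh t · u + sinh t · σ₀* v σ₀ = u' diag(e^s) T` with `T`
unipotent upper triangular (`exists_y_eq`). Hence `x_t(k) = T* diag(e^{2s}) T`, its leading minors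
are `exp(2(s₁ + … + s_r))` (`minor_eq`), and summation by parts yields `Δ_μ(x_t(k)) = exp(2 ∑ μ_r
s_r)` (`powerFun_eq`). For `μ = (iλ - ρ)/2` this is the Harish-Chandra integrand (`hcIntegrand_eq`);
the value of `ρ` never enters.

The minors also recover `s`, so the projection is unique. For existence, take the `QR` decomposition
of `a_t k` in an orthonormal basis of weight vectors, ordered from high to low weight. Since the
whole matrix preserves the Hermitian form, so does the triangular factor
(`qr_factor_preserves_form`), and dividing it by its diagonal leaves a unipotent matrix that
preserves the form. Its logarithm is a polynomial, lies in the Lie algebra, and splits into positive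
root vectors (`exists_strictUpper_exp_eq`, `ofWt_mem_nilAlg`).

The unitary factor lies in `K`, not only in `U(q) × U(p)`: for `ℂ` by determinants, for `ℝ` by
deforming `t` to `0` as well (`det_y_pos`). Integrability is continuity on the compact group `K`.
Only the determinant and the group `K` depend on the scalars; what is needed of them is collected in
`LawfulDet`. -/

/-- In `F` the product `a* a` is the square of the norm. -/
class NormStar (F : Type) [NormedDivisionRing F] [NormedAlgebra ℝ F] [StarRing F] : Prop where
  star_mul_self_eq : ∀ a : F, star a * a = algebraMap ℝ F (‖a‖ ^ 2)

/-! ### Cholesky and `QR` decompositions over a possibly noncommutative `F`. -/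

section Cholesky

variable {F : Type} [NormedDivisionRing F] [NormedAlgebra ℝ F] [StarRing F]

theorem star_algebraMap_real [StarModule ℝ F] (c : ℝ) :
    star (algebraMap ℝ F c) = algebraMap ℝ F c := by
  rw [Algebra.algebraMap_eq_smul_one, star_smul, star_one, star_trivial]

theorem algebraMap_real_injective : Function.Injective (algebraMap ℝ F) :=
  (algebraMap ℝ F).injective

variable [NormStar F]

/-- For `a ≠ 0` the star is `‖a‖² a⁻¹`, which commutes with `a` because real scalars are central. -/
theorem self_mul_star_eq (a : F) : a * star a = algebraMap ℝ F (‖a‖ ^ 2) := by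
  by_cases ha : a = 0
  · simp [ha]
  · have h : star a = algebraMap ℝ F (‖a‖ ^ 2) * a⁻¹ := by
      rw [← NormStar.star_mul_self_eq, mul_assoc, mul_inv_cancel₀ ha, mul_one]
    rw [h, ← mul_assoc, ← Algebra.commutes, mul_assoc, mul_inv_cancel₀ ha, mul_one]

theorem star_dotProduct_self_eq {n : Type} [Fintype n] (v : n → F) :
    star v ⬝ᵥ v = algebraMap ℝ F (∑ i, ‖v i‖ ^ 2) := by
  simp [dotProduct, NormStar.star_mul_self_eq]

theorem sum_norm_sq_pos {n : Type} [Fintype n] {v : n → F} (hv : v ≠ 0) :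
    0 < ∑ i, ‖v i‖ ^ 2 := by
  obtain ⟨i, hi⟩ := Function.ne_iff.mp hv
  refine Finset.sum_pos' (fun i _ => by positivity) ⟨i, Finset.mem_univ _, ?_⟩
  have : 0 < ‖v i‖ := norm_pos_iff.mpr hi
  positivity

/-- A matrix `Y* Y` with `Y` left invertible is in the cone of positive definite matrices. -/
theorem conjTranspose_mul_self_mem_Omega {n : ℕ} {m : Type} [Fintype m] {Y : Matrix m (Fin n) F}
    {Z : Matrix (Fin n) m F} (h : Z * Y = 1) : Yᴴ * Y ∈ Omega F n := by
  refine ⟨by simp, fun v hv => ⟨∑ i, ‖(Y *ᵥ v) i‖ ^ 2, sum_norm_sq_pos ?_, ?_⟩⟩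
  · intro h0
    apply hv
    rw [← Matrix.one_mulVec v, ← h, ← Matrix.mulVec_mulVec, h0, Matrix.mulVec_zero]
  · rw [← star_dotProduct_self_eq, ← Matrix.mulVec_mulVec, Matrix.dotProduct_mulVec,
      Matrix.star_mulVec]

variable [StarModule ℝ F]

/-- Cholesky decomposition of a positive definite matrix, together with the inverse of the
triangular factor. -/
theorem exists_cholesky : ∀ (n : ℕ) (P : Matrix (Fin n) (Fin n) F), P ∈ Omega F n →
    ∃ R R' : Matrix (Fin n) (Fin n) F, R' * R = 1 ∧ (∀ i j, j < i → R i j = 0) ∧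
      (∀ i j, j < i → R' i j = 0) ∧ (∃ r : Fin n → ℝ, ∀ i, 0 < r i ∧ R i i = algebraMap ℝ F (r i)) ∧
      P = Rᴴ * R := by
  intro n
  induction n with
  | zero =>
    intro P _
    refine ⟨1, 1, by simp, fun i => i.elim0, fun i => i.elim0, ⟨fun i => i.elim0, fun i => i.elim0⟩,
      ?_⟩
    ext i; exact i.elim0
  | succ n ih =>
    rintro P ⟨hPs, hP⟩
    have hstar : ∀ i j, star (P i j) = P j i := fun i j => by
      rw [← Matrix.conjTranspose_apply, hPs]
    obtain ⟨c, hc, hc'⟩ := hP (Pi.single 0 1) (by simp)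
    have h00 : P 0 0 = algebraMap ℝ F c := by
      rw [← hc', ← Pi.single_star, star_one, single_one_dotProduct, Matrix.mulVec_single_one]
      rfl
    set d : F := algebraMap ℝ F (Real.sqrt c)⁻¹ with hd
    have hdc : ∀ z : F, z * d = d * z := fun z => (Algebra.commutes _ _).symm
    have hsq : Real.sqrt c ≠ 0 := (Real.sqrt_pos.mpr hc).ne'
    have hsd : algebraMap ℝ F (Real.sqrt c) * d = 1 := by
      rw [hd, ← map_mul, mul_inv_cancel₀ hsq, map_one]
    have hds : d * algebraMap ℝ F (Real.sqrt c) = 1 := by rw [← hdc, hsd]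
    have hdd : algebraMap ℝ F c * (d * d) = 1 := by
      have : algebraMap ℝ F c = algebraMap ℝ F (Real.sqrt c) * algebraMap ℝ F (Real.sqrt c) := by
        rw [← map_mul, Real.mul_self_sqrt hc.le]
      rw [this, mul_assoc, ← mul_assoc _ d d, hsd, one_mul, hsd]
    have hdstar : star d = d := star_algebraMap_real _
    -- The Schur complement of the corner `c`, where `d * d = c⁻¹`, is again positive definite,
    -- which drives the induction.
    have hD : (Matrix.of fun i j => P i.succ j.succ - P i.succ 0 * (d * d) * P 0 j.succ :
        Matrix (Fin n) (Fin n) F) ∈ Omega F n := by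
      refine ⟨?_, fun v hv => ?_⟩
      · ext i j
        simp [hstar, hdstar, mul_assoc]
      · set S := ∑ j, P 0 (Fin.succ j) * v j with hS
        -- The first coordinate is chosen so that `P` sends this vector to one with first coordinate
        -- `0`; the form of `P` there is the form of the Schur complement at `v`.
        have hw : (Fin.cons (-(d * d * S)) v : Fin (n + 1) → F) ≠ 0 := by
          intro h0
          apply hv
          ext j
          simpa using congrFun h0 j.succ
        obtain ⟨e, he, he'⟩ := hP _ hw
        refine ⟨e, he, ?_⟩
        rw [← he', dotProduct, dotProduct, Fin.sum_univ_succ]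
        have h1 : (P *ᵥ (Fin.cons (-(d * d * S)) v : Fin (n + 1) → F)) 0 = 0 := by
          simp only [Matrix.mulVec, dotProduct, Fin.sum_univ_succ, Fin.cons_zero, Fin.cons_succ]
          rw [← hS, h00, mul_neg, ← mul_assoc, hdd, one_mul, neg_add_cancel]
        rw [h1, mul_zero, zero_add]
        refine Finset.sum_congr rfl fun i _ => ?_
        simp only [Pi.star_apply, Fin.cons_succ]
        congr 1
        simp only [Matrix.mulVec, dotProduct, Fin.sum_univ_succ, Fin.cons_zero, Fin.cons_succ,
          Matrix.of_apply, sub_mul, Finset.sum_sub_distrib, hS]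
        simp only [mul_neg, mul_assoc, Finset.mul_sum]
        abel
    obtain ⟨R, R', h1, h2, h3, ⟨r, hr⟩, h4⟩ := ih _ hD
    set w : Fin n → F := fun j => d * P 0 j.succ with hw
    -- In blocks, the factor is `(√c, w; 0, R)` with `w = c^(-1/2) b` for the first row `b` of `P`
    -- past the corner, and its inverse is `(d, -d w R'; 0, R')`.
    refine ⟨Matrix.of (Fin.cons (Fin.cons (algebraMap ℝ F (Real.sqrt c)) w) fun i =>
        Fin.cons 0 (R i)), Matrix.of (Fin.cons (Fin.cons d fun j => -(d * (w ᵥ* R') j)) fun i =>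
        Fin.cons 0 (R' i)), ?_, ?_, ?_, ⟨Fin.cons (Real.sqrt c) r, ?_⟩, ?_⟩
    · ext i j
      rw [Matrix.mul_apply, Fin.sum_univ_succ]
      refine Fin.cases ?_ (fun i => ?_) i <;> refine Fin.cases ?_ (fun j => ?_) j
      · simp [hds]
      · have : ∑ l, (w ᵥ* R') l * R l j = w j := by
          change ((w ᵥ* R') ᵥ* R) j = w j
          rw [Matrix.vecMul_vecMul, h1, Matrix.vecMul_one]
        simp [mul_assoc, ← Finset.mul_sum, this, Fin.ext_iff]
      · simp [Fin.ext_iff]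
      · have := congrFun (congrFun h1 i) j
        rw [Matrix.mul_apply] at this
        simp [this, Matrix.one_apply]
    · intro i j
      refine Fin.cases ?_ (fun i => ?_) i <;> refine Fin.cases ?_ (fun j => ?_) j
      · simp
      · simp
      · simp
      · simpa using h2 i j
    · intro i j
      refine Fin.cases ?_ (fun i => ?_) i <;> refine Fin.cases ?_ (fun j => ?_) j
      · simp
      · simp
      · simp
      · simpa using h3 i j
    · intro i
      refine Fin.cases ?_ (fun i => ?_) i
      · simpa using hc
      · simpa using hr i
    · ext i j
      rw [Matrix.mul_apply, Fin.sum_univ_succ]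
      refine Fin.cases ?_ (fun i => ?_) i <;> refine Fin.cases ?_ (fun j => ?_) j
      · simp [star_algebraMap_real, ← map_mul, Real.mul_self_sqrt hc.le, h00]
      · simp [star_algebraMap_real, hw, ← mul_assoc, hsd]
      · simp [hw, hdstar, hstar, mul_assoc, hds]
      · have := congrFun (congrFun h4 i) j
        rw [Matrix.mul_apply] at this
        simp only [Matrix.of_apply, Matrix.conjTranspose_apply] at this
        simp [← this, hw, hdstar, hstar, mul_assoc]

/-- `QR` decomposition of an invertible matrix, with respect to the order of the index set given by
an injective function. -/
theorem exists_qr {B : Type} [Fintype B] [DecidableEq B] {key : B → ℤ}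
    (hkey : Function.Injective key) {A A' : Matrix B B F} (hA : A' * A = 1) :
    ∃ V R R' : Matrix B B F, Vᴴ * V = 1 ∧ R' * R = 1 ∧ (∀ i j, key j < key i → R i j = 0) ∧
      (∀ i j, key j < key i → R' i j = 0) ∧ (∃ r : B → ℝ, ∀ i, 0 < r i ∧
      R i i = algebraMap ℝ F (r i)) ∧ A = V * R := by
  -- The index set is enumerated in the order of `key`, so that triangularity on `Fin` becomes
  -- triangularity with respect to `key`.
  let _ : LinearOrder B := LinearOrder.lift' key hkey
  let e := Fintype.orderIsoFinOfCardEq B rfl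
  have hlt : ∀ i j, key j < key i → e.symm j < e.symm i := fun i j h => e.symm.lt_iff_lt.mpr h
  have hP : (A.submatrix id e)ᴴ * A.submatrix id e ∈ Omega F (Fintype.card B) := by
    refine conjTranspose_mul_self_mem_Omega (Z := A'.submatrix e id) ?_
    rw [← Matrix.submatrix_mul _ _ _ _ _ Function.bijective_id, hA]
    exact Matrix.submatrix_one e e.injective
  obtain ⟨R, R', h1, h2, h3, ⟨r, hr⟩, h4⟩ := exists_cholesky _ _ hP
  have h5 : Aᴴ * A = (R.submatrix e.symm e.symm)ᴴ * R.submatrix e.symm e.symm := by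
    rw [Matrix.conjTranspose_submatrix, ← Matrix.submatrix_mul _ _ _ _ _ e.symm.bijective, ← h4]
    ext i j
    simp [Matrix.mul_apply]
  have h6 : R'.submatrix e.symm e.symm * R.submatrix e.symm e.symm = 1 := by
    rw [← Matrix.submatrix_mul _ _ _ _ _ e.symm.bijective, h1]
    exact Matrix.submatrix_one _ e.symm.injective
  have h7 : R.submatrix e.symm e.symm * R'.submatrix e.symm e.symm = 1 := mul_eq_one_comm.mp h6
  refine ⟨A * R'.submatrix e.symm e.symm, R.submatrix e.symm e.symm, R'.submatrix e.symm e.symm, ?_,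
    h6, fun i j h => h2 _ _ (hlt _ _ h), fun i j h => h3 _ _ (hlt _ _ h),
    ⟨r ∘ e.symm, fun i => hr _⟩, by rw [mul_assoc, h6, mul_one]⟩
  rw [Matrix.conjTranspose_mul, mul_assoc, ← mul_assoc Aᴴ, h5, mul_assoc, h7, mul_one,
    ← Matrix.conjTranspose_mul, h7, Matrix.conjTranspose_one]

end Cholesky

/-! ### Exponential and logarithm of nilpotent elements. -/

section NilpotentLog

theorem exists_nilpotent_exp_eq {A : Type*} [Ring A] [Algebra ℚ A] {w : A} (hw : IsNilpotent w) :
    ∃ c, IsNilpotent.exp w = 1 + w + w * w * c := by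
  obtain ⟨N, hN⟩ := hw
  have h : w ^ (N + 2) = 0 := by rw [pow_add, hN, zero_mul]
  refine ⟨∑ i ∈ Finset.range N, ((i + 2).factorial : ℚ)⁻¹ • w ^ i, ?_⟩
  rw [IsNilpotent.exp_eq_sum h, Finset.sum_range_succ', Finset.sum_range_succ', Finset.mul_sum]
  simp only [mul_smul_comm, ← pow_two, ← pow_add, add_comm 2]
  simp [add_comm, add_left_comm, add_assoc]

/-- From `exp w = 1` one gets `w = -w² c`. Substituting this into itself puts `w` in `w^k A` for
every `k`, hence `w = 0`. -/
theorem eq_zero_of_nilpotent_exp_eq_one {A : Type*} [Ring A] [Algebra ℚ A] {w : A}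
    (hw : IsNilpotent w) (h : IsNilpotent.exp w = 1) : w = 0 := by
  obtain ⟨c, hc⟩ := exists_nilpotent_exp_eq hw
  rw [h, add_assoc, left_eq_add] at hc
  have h1 : w * (1 + w * c) = 0 := by rw [mul_add, mul_one, ← mul_assoc, hc]
  have key : ∀ k : ℕ, ∃ d, w = w ^ (k + 1) * d := by
    intro k
    induction k with
    | zero => exact ⟨1, by simp⟩
    | succ k ih =>
      obtain ⟨d, hd⟩ := ih
      have h2 : w = w * w * (-c) := by
        rw [mul_neg]; exact eq_neg_of_add_eq_zero_left hc
      refine ⟨d * (-c), ?_⟩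
      calc w = w * w * (-c) := h2
        _ = w * (w ^ (k + 1) * d) * (-c) := by rw [← hd]
        _ = _ := by rw [pow_succ' w (k + 1)]; simp only [mul_assoc]
  obtain ⟨N, hN⟩ := hw
  obtain ⟨d, hd⟩ := key N
  rw [hd, pow_succ, hN, zero_mul, zero_mul]

/-- Successive approximation replaces the power series of the logarithm: an error of order `z^(k+1)`
is removed by one more exponential factor, and nilpotency stops the process. -/
theorem exists_nilpotent_exp_mul_eq {A : Type*} [CommRing A] [Algebra ℚ A] {z : A}
    (hz : IsNilpotent z) : ∃ p, IsNilpotent.exp (z * p) = 1 + z := by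
  have key : ∀ k : ℕ, ∃ p r, IsNilpotent.exp (-(z * p)) * (1 + z) = 1 + z ^ (k + 1) * r := by
    intro k
    induction k with
    | zero => exact ⟨0, 1, by simp [IsNilpotent.exp_zero]⟩
    | succ k ih =>
      obtain ⟨p, r, h⟩ := ih
      have h1 : IsNilpotent (-(z * p)) := (Commute.isNilpotent_mul_right (Commute.all _ _) hz).neg
      have h2 : IsNilpotent (-(z ^ (k + 1) * r)) := by
        rw [pow_succ', mul_assoc]
        exact (Commute.isNilpotent_mul_right (Commute.all _ _) hz).neg
      obtain ⟨c, hc⟩ := exists_nilpotent_exp_eq h2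
      -- The extra factor `exp(-z^(k+1) r)` cancels the error to first order. What remains is
      -- divisible by `z^(2k+2)`, hence by `z^(k+2)`.
      refine ⟨p + z ^ k * r, z ^ k * r * r * (-1 + c + z ^ (k + 1) * r * c), ?_⟩
      have : -(z * (p + z ^ k * r)) = -(z * p) + -(z ^ (k + 1) * r) := by ring
      rw [this, IsNilpotent.exp_add_of_commute (Commute.all _ _) h1 h2, mul_right_comm, h, hc]
      ring
  obtain ⟨N, hN⟩ := hz
  obtain ⟨p, r, h⟩ := key N
  refine ⟨p, ?_⟩
  rw [pow_succ, hN, zero_mul, zero_mul, add_zero] at h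
  have h1 : IsNilpotent (z * p) := Commute.isNilpotent_mul_right (Commute.all _ _) ⟨N, hN⟩
  calc IsNilpotent.exp (z * p) = IsNilpotent.exp (z * p) *
        (IsNilpotent.exp (-(z * p)) * (1 + z)) := by rw [h, mul_one]
    _ = 1 + z := by rw [← mul_assoc, IsNilpotent.exp_mul_exp_neg_self h1, one_mul]

/-- The logarithm of a unipotent element, as a polynomial. -/
theorem exists_nilpotent_exp_aeval_eq {A : Type*} [Ring A] [Algebra ℚ A] {z : A}
    (hz : IsNilpotent z) : ∃ P : Polynomial ℚ,
      IsNilpotent.exp (z * Polynomial.aeval z P) = 1 + z := by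
  obtain ⟨N, hN⟩ := hz
  -- The logarithm is found in the commutative ring `ℚ[X]/(X^N)` and carried to `A` by `X ↦ z`.
  let I : Ideal (Polynomial ℚ) := Ideal.span {Polynomial.X ^ N}
  have hI : ∀ a ∈ I, Polynomial.aeval z a = 0 := by
    intro a ha
    obtain ⟨b, rfl⟩ := Ideal.mem_span_singleton.mp ha
    simp [hN]
  have hX : IsNilpotent (Ideal.Quotient.mk I Polynomial.X) :=
    ⟨N, by
      rw [← map_pow]
      exact Ideal.Quotient.eq_zero_iff_mem.mpr (Ideal.mem_span_singleton_self _)⟩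
  obtain ⟨p, hp⟩ := exists_nilpotent_exp_mul_eq hX
  obtain ⟨P, rfl⟩ := Ideal.Quotient.mk_surjective p
  refine ⟨P, ?_⟩
  let f : (Polynomial ℚ ⧸ I) →ₐ[ℚ] A := Ideal.Quotient.liftₐ I (Polynomial.aeval z) hI
  have hf : ∀ a, f (Ideal.Quotient.mk I a) = Polynomial.aeval z a := fun a => rfl
  have h := congrArg f hp
  rw [IsNilpotent.map_exp (Commute.isNilpotent_mul_right (Commute.all _ _) hX)] at h
  simpa [hf] using h

theorem exp_eq_nilpotent_exp {A : Type*} [Ring A] [Algebra ℚ A] [TopologicalSpace A]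
    [IsTopologicalRing A] [T2Space A] {w : A} (hw : IsNilpotent w) :
    NormedSpace.exp w = IsNilpotent.exp w := by
  obtain ⟨N, hN⟩ := hw
  rw [NormedSpace.exp_eq_tsum ℚ, IsNilpotent.exp_eq_sum hN]
  refine tsum_eq_sum fun i hi => ?_
  rw [pow_eq_zero_of_le (by simpa using hi) hN, smul_zero]

end NilpotentLog

/-! ### Unipotent triangular matrices and their logarithms. -/

section Unipotent

variable {B : Type} {R : Type}

/-- `X` is strictly upper triangular with respect to the preorder of the index set given by `b`. -/
def StrictUpper [Zero R] (b : B → ℤ) (X : Matrix B B R) : Prop :=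
  ∀ i j, b j ≤ b i → X i j = 0

theorem StrictUpper.blockTriangular [Zero R] {b : B → ℤ} {X : Matrix B B R}
    (h : StrictUpper b X) : X.BlockTriangular b :=
  fun i j hij => h i j hij.le

variable [Fintype B]

theorem StrictUpper.mul_blockTriangular [NonUnitalNonAssocSemiring R] {b : B → ℤ}
    {X Y : Matrix B B R} (hX : StrictUpper b X) (hY : Y.BlockTriangular b) :
    StrictUpper b (X * Y) := by
  intro i j hij
  rw [Matrix.mul_apply]
  refine Finset.sum_eq_zero fun k _ => ?_
  by_cases h : b k ≤ b i
  · rw [hX i k h, zero_mul]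
  · rw [hY (lt_of_le_of_lt hij (not_le.mp h)), mul_zero]

variable [DecidableEq B]

/-- Each factor of `X` raises the level by at least one, while the differences of levels are
bounded. -/
theorem StrictUpper.isNilpotent [Semiring R] {b : B → ℤ} {X : Matrix B B R}
    (hX : StrictUpper b X) : IsNilpotent X := by
  have key : ∀ (k : ℕ) i j, b j < b i + k → (X ^ k) i j = 0 := by
    intro k
    induction k with
    | zero =>
      intro i j h
      rw [pow_zero, Matrix.one_apply_ne]
      rintro rfl
      simp at h
    | succ k ih =>
      intro i j h
      rw [pow_succ, Matrix.mul_apply]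
      refine Finset.sum_eq_zero fun l _ => ?_
      by_cases hl : b l < b i + k
      · rw [ih i l hl, zero_mul]
      · rw [hX l j (by push_cast at h; omega), mul_zero]
  -- Every level has absolute value at most `∑ |b i|`, so this exponent exceeds every difference of
  -- two levels.
  refine ⟨(∑ i, |b i|).toNat + (∑ i, |b i|).toNat + 1, ?_⟩
  ext i j
  refine key _ i j ?_
  have h : ∀ i, |b i| ≤ ∑ i, |b i| := fun i =>
    Finset.single_le_sum (f := fun i => |b i|) (fun _ _ => abs_nonneg _) (Finset.mem_univ i)
  have hi := abs_le.mp (h i)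
  have hj := abs_le.mp (h j)
  push_cast
  omega

theorem StrictUpper.mul_aeval [Ring R] [Algebra ℚ R] {b : B → ℤ} {X : Matrix B B R}
    (hX : StrictUpper b X) (P : Polynomial ℚ) :
    StrictUpper b (X * Polynomial.aeval X P) := by
  refine hX.mul_blockTriangular ?_
  rw [← Matrix.mem_blockTriangularSubalgebra (R := ℚ)]
  exact Algebra.adjoin_le (Set.singleton_subset_iff.mpr hX.blockTriangular)
    (Polynomial.aeval_mem_adjoin_singleton ℚ X)

theorem StrictUpper.exp_sub_one [Ring R] [Algebra ℚ R] [TopologicalSpace R] [IsTopologicalRing R]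
    [T2Space R] {b : B → ℤ} {X : Matrix B B R} (hX : StrictUpper b X) :
    StrictUpper b (NormedSpace.exp X - 1) := by
  obtain ⟨N, hN⟩ := hX.isNilpotent
  have hN' : X ^ (N + 1) = 0 := by rw [pow_succ, hN, zero_mul]
  rw [exp_eq_nilpotent_exp hX.isNilpotent, IsNilpotent.exp_eq_sum hN', Finset.sum_range_succ']
  simp only [pow_zero, Nat.factorial_zero, Nat.cast_one, inv_one, one_smul, add_sub_cancel_right]
  intro i j hij
  rw [Matrix.sum_apply]
  refine Finset.sum_eq_zero fun k _ => ?_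
  rw [Matrix.smul_apply, pow_succ', hX.mul_blockTriangular (hX.blockTriangular.pow k) i j hij,
    smul_zero]

theorem det_eq_one_of_strictUpper_sub_one [CommRing R] {b : B → ℤ} {M : Matrix B B R}
    (hM : StrictUpper b (M - 1)) : M.det = 1 := by
  have h : M.BlockTriangular b := by
    intro i j hij
    have := hM i j hij.le
    rw [Matrix.sub_apply, Matrix.one_apply_ne (fun h => by simp [h] at hij), sub_zero] at this
    exact this
  rw [h.det]
  refine Finset.prod_eq_one fun k _ => ?_
  have : M.toSquareBlock b k = 1 := by
    ext ⟨i, hi⟩ ⟨j, hj⟩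
    have := hM i j (by rw [hi, hj])
    rw [Matrix.sub_apply, sub_eq_zero] at this
    simp [Matrix.toSquareBlock_def, this, Matrix.one_apply]
  rw [this, Matrix.det_one]

/-- The map `X ↦ J X* J` is an anti-automorphism, so it respects powers. As the series is a finite
sum, no continuity of the star is needed. -/
theorem nilpotent_exp_conj_conjTranspose [Ring R] [Algebra ℚ R] [StarRing R]
    {J X : Matrix B B R} (hJ : J * J = 1) (hX : IsNilpotent X) :
    IsNilpotent (J * Xᴴ * J) ∧
      IsNilpotent.exp (J * Xᴴ * J) = J * (IsNilpotent.exp X)ᴴ * J := by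
  have hpow : ∀ k : ℕ, (J * Xᴴ * J) ^ k = J * (X ^ k)ᴴ * J := by
    intro k
    induction k with
    | zero => simp [hJ]
    | succ k ih =>
      rw [pow_succ, ih, pow_succ' X, Matrix.conjTranspose_mul]
      calc J * (X ^ k)ᴴ * J * (J * Xᴴ * J) = J * (X ^ k)ᴴ * (J * J) * Xᴴ * J := by
            simp only [mul_assoc]
        _ = _ := by rw [hJ, mul_one]; simp only [mul_assoc]
  obtain ⟨N, hN⟩ := hX
  have h0 : (J * Xᴴ * J) ^ N = 0 := by rw [hpow, hN]; simp
  refine ⟨⟨N, h0⟩, ?_⟩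
  rw [IsNilpotent.exp_eq_sum h0, IsNilpotent.exp_eq_sum hN, Matrix.conjTranspose_sum,
    Finset.mul_sum, Finset.sum_mul]
  refine Finset.sum_congr rfl fun k _ => ?_
  rw [hpow, Matrix.conjTranspose_rat_smul]
  simp

/-- A unipotent upper triangular matrix preserving the Hermitian form `J` is the exponential of a
strictly upper triangular matrix in the Lie algebra. -/
theorem exists_strictUpper_exp_eq [Ring R] [Algebra ℚ R] [StarRing R] [TopologicalSpace R]
    [IsTopologicalRing R] [T2Space R] [IsStablyFiniteRing R] {b : B → ℤ} {J n : Matrix B B R}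
    (hJ : J * J = 1) (hJs : Jᴴ = J) (hn : StrictUpper b (n - 1)) (hnJ : n * (J * nᴴ * J) = 1) :
    ∃ X, StrictUpper b X ∧ J * Xᴴ * J = -X ∧ NormedSpace.exp X = n := by
  set z := n - 1 with hz
  have hn1 : n = 1 + z := by simp [hz]
  obtain ⟨P, hP⟩ := exists_nilpotent_exp_aeval_eq hn.isNilpotent
  set X := z * Polynomial.aeval z P with hX
  have hXs : StrictUpper b X := hn.mul_aeval P
  refine ⟨X, hXs, ?_, by rw [exp_eq_nilpotent_exp hXs.isNilpotent, hP, hn1]⟩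
  obtain ⟨h1, h2⟩ := nilpotent_exp_conj_conjTranspose hJ hXs.isNilpotent
  -- The logarithm `X` is a polynomial in `z`, so whatever commutes with `z` commutes with `X`.
  have hcomm : ∀ w, Commute w z → Commute w X := by
    intro w hw
    have h : Polynomial.aeval z P ∈ Subalgebra.centralizer ℚ {w} :=
      Algebra.adjoin_le (Set.singleton_subset_iff.mpr
        (Subalgebra.mem_centralizer_iff ℚ |>.mpr fun g hg => by
          rw [Set.mem_singleton_iff.mp hg]; exact hw.eq))
        (Polynomial.aeval_mem_adjoin_singleton ℚ z)
    exact hw.mul_right ((Subalgebra.mem_centralizer_iff ℚ).mp h w rfl)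
  have hJJ : ∀ w : Matrix B B R, J * (J * wᴴ * J)ᴴ * J = w := by
    intro w
    rw [Matrix.conjTranspose_mul, Matrix.conjTranspose_mul, hJs, Matrix.conjTranspose_conjTranspose]
    calc J * (J * (w * J)) * J = (J * J) * w * (J * J) := by simp only [mul_assoc]
      _ = w := by rw [hJ, one_mul, mul_one]
  have hflip : ∀ w w', Commute (J * wᴴ * J) w' → Commute w (J * w'ᴴ * J) := by
    intro w w' h
    have hm : ∀ a c : Matrix B B R, J * (a * c)ᴴ * J = (J * cᴴ * J) * (J * aᴴ * J) := by
      intro a c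
      rw [Matrix.conjTranspose_mul]
      calc J * (cᴴ * aᴴ) * J = J * cᴴ * 1 * aᴴ * J := by simp only [mul_assoc, mul_one]
        _ = _ := by rw [← hJ]; simp only [mul_assoc]
    have h' := congrArg (fun a => J * aᴴ * J) h.eq
    simp only [hm (J * wᴴ * J) w', hm w' (J * wᴴ * J), hJJ] at h'
    exact h'.symm
  -- The matrix `n` commutes with its inverse `J n* J`. Removing the identity from both gives
  -- commutation of the nilpotent parts.
  have hzz : Commute (J * zᴴ * J) z := by
    have h3 : J * nᴴ * J = 1 + J * zᴴ * J := by
      rw [hn1, Matrix.conjTranspose_add, Matrix.conjTranspose_one, mul_add, add_mul, mul_one, hJ]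
    have h4 : (J * nᴴ * J) * n = n * (J * nᴴ * J) := by rw [hnJ, mul_eq_one_comm.mp hnJ]
    rw [h3, hn1] at h4
    have h5 : (J * zᴴ * J) * z = z * (J * zᴴ * J) := by
      simp only [add_mul, mul_add, one_mul, mul_one] at h4
      have : ∀ a c d e : Matrix B B R, 1 + a + (c + d) = 1 + c + (a + e) → d = e := by
        intro a c d e h
        have : 1 + a + c + d = 1 + a + c + e := by
          rw [add_assoc, h]; abel
        exact add_left_cancel this
      exact this _ _ _ _ h4
    exact h5
  have hXJ : Commute X (J * Xᴴ * J) :=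
    (hcomm _ (hflip z X (hcomm _ hzz)).symm).symm
  -- As the two exponents commute, the exponential of their sum is `n (J n* J) = 1`, so the
  -- nilpotent sum vanishes.
  have h6 : IsNilpotent.exp (X + J * Xᴴ * J) = 1 := by
    rw [IsNilpotent.exp_add_of_commute hXJ hXs.isNilpotent h1, h2, hP, ← hn1, hnJ]
  have h7 := eq_zero_of_nilpotent_exp_eq_one
    (hXJ.isNilpotent_add hXs.isNilpotent h1) h6
  exact eq_neg_of_add_eq_zero_right h7

end Unipotent

/-! ### Weights of `𝔞` on `F^{q+p}` and their order. -/

/-- The index set of a basis of weight vectors of `𝔞` in `F^{q+p}`: the weights are `fᵢ`, `-fᵢ`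
and `0`. -/
abbrev WIdx (q p : ℕ) : Type := Fin q ⊕ (Fin q ⊕ Fin (p - q))

section Weights

variable {q p : ℕ}

/-- The value of a weight at `H_s`. -/
def wt (s : Fin q → ℝ) : WIdx q p → ℝ :=
  Sum.elim s (Sum.elim (fun i => -s i) fun _ => 0)

/-- The level of a weight, decreasing in the dominance order. -/
def lvl : WIdx q p → ℤ :=
  Sum.elim (fun i => (i : ℤ) - q) (Sum.elim (fun i => (q : ℤ) - i) fun _ => 0)

/-- An injective refinement of `lvl`. -/
def fineLvl : WIdx q p → ℤ :=
  Sum.elim (fun i => (i : ℤ) - q) (Sum.elim (fun i => (p : ℤ) - i) fun l => (l : ℤ))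

theorem fineLvl_injective (hqp : q ≤ p) : Function.Injective (fineLvl (q := q) (p := p)) := by
  rintro (i | i | i) (j | j | j) h <;> simp [fineLvl] at h <;> simp [Fin.ext_iff] <;> omega

theorem fineLvl_lt (hqp : q ≤ p) {a b : WIdx q p} (h : lvl a < lvl b) : fineLvl a < fineLvl b := by
  rcases a with i | i | i <;> rcases b with j | j | j <;> simp [lvl] at h <;>
    simp [fineLvl] <;> omega

/-- The involution of the weights induced by the Hermitian form. -/
def flipIdx : WIdx q p → WIdx q p :=
  Sum.elim (fun i => Sum.inr (Sum.inl i)) (Sum.elim Sum.inl fun l => Sum.inr (Sum.inr l))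

theorem wt_flipIdx (s : Fin q → ℝ) (a : WIdx q p) : wt s (flipIdx a) = -wt s a := by
  rcases a with i | i | i <;> simp [wt, flipIdx]

theorem lvl_flipIdx (a : WIdx q p) : lvl (flipIdx a) = -lvl a := by
  rcases a with i | i | i <;> simp [lvl, flipIdx]

theorem wt_sum (s : Fin q → ℝ) : ∑ a : WIdx q p, wt s a = 0 := by
  simp [wt, Fintype.sum_sum_type]

/-- The weight as a vector of coefficients of `f₁, …, f_q`. -/
def wtCoeff : WIdx q p → Fin q → ℝ :=
  Sum.elim (fun i => Pi.single i 1) (Sum.elim (fun i => -Pi.single i 1) fun _ => 0)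

theorem wt_eq_sum (s : Fin q → ℝ) (a : WIdx q p) : wt s a = ∑ i, wtCoeff a i * s i := by
  rcases a with i | i | i <;> simp [wt, wtCoeff, Pi.single_apply]

/-- Differences of weights of increasing level are positive roots. -/
theorem wtCoeff_sub_mem_posRoots {a b : WIdx q p} (h : lvl a < lvl b) :
    wtCoeff a - wtCoeff b ∈ posRoots q := by
  have hs : ∀ i : Fin q, (Pi.single i 1 : Fin q → ℝ) + Pi.single i 1 = Pi.single i 2 := by
    intro i; rw [← Pi.single_add]; norm_num
  simp only [posRoots, Finset.mem_union, Finset.mem_image, Finset.mem_univ, true_and,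
    Set.mem_toFinset, Set.mem_ofPred_eq, Prod.exists]
  rcases a with i | i | i <;> rcases b with j | j | j <;>
    simp only [lvl, Sum.elim_inl, Sum.elim_inr] at h <;>
    simp only [wtCoeff, Sum.elim_inl, Sum.elim_inr]
  · exact Or.inl (Or.inr ⟨i, j, by omega, rfl⟩)
  · rw [sub_neg_eq_add]
    rcases lt_trichotomy i j with hij | rfl | hij
    · exact Or.inr ⟨i, j, hij, rfl⟩
    · exact Or.inl (Or.inl (Or.inr ⟨i, (hs i).symm⟩))
    · exact Or.inr ⟨j, i, hij, add_comm _ _⟩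
  · exact Or.inl (Or.inl (Or.inl ⟨i, by simp⟩))
  · omega
  · exact Or.inl (Or.inr ⟨j, i, by omega, by abel⟩)
  · omega
  · omega
  · exact Or.inl (Or.inl (Or.inl ⟨j, by simp⟩))
  · omega

/-- A dominant regular element. -/
def domReg (q : ℕ) : Fin q → ℝ := fun i => (q : ℝ) - i

theorem wt_domReg (a : WIdx q p) : wt (domReg q) a = -(lvl a : ℝ) := by
  rcases a with i | i | i <;> simp [wt, domReg, lvl]

/-- The coordinates `q - i` are positive and strictly decreasing, so this single element of `𝔞`
separates positive roots from zero. -/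
theorem posRoots_domReg_pos {α : Fin q → ℝ} (hα : α ∈ posRoots q) :
    0 < ∑ i, α i * domReg q i := by
  have hpos : ∀ i : Fin q, 0 < domReg q i := fun i => by
    have : ((i : ℕ) : ℝ) < q := by exact_mod_cast i.isLt
    simp [domReg, this]
  have hlt : ∀ i j : Fin q, i < j → domReg q j < domReg q i := fun i j h => by
    have : ((i : ℕ) : ℝ) < (j : ℕ) := by exact_mod_cast h
    simp [domReg, this]
  simp only [posRoots, Finset.mem_union, Finset.mem_image, Finset.mem_univ, true_and,
    Set.mem_toFinset, Set.mem_ofPred_eq, Prod.exists] at hα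
  rcases hα with ((⟨i, rfl⟩ | ⟨i, rfl⟩) | ⟨i, j, hij, rfl⟩) | ⟨i, j, hij, rfl⟩
  · simpa [Pi.single_apply] using hpos i
  · simpa [Pi.single_apply] using hpos i
  · simpa [Pi.single_apply, sub_mul] using hlt i j hij
  · simpa [Pi.single_apply, add_mul, Finset.sum_add_distrib] using add_pos (hpos i) (hpos j)

end Weights

/-! ### The orthonormal basis of weight vectors and the Hermitian form in it. -/

section WeightBasis

variable (F : Type) [NormedDivisionRing F] [NormedAlgebra ℝ F] [StarRing F]
variable (q p : ℕ)

/-- The lower `p - q` standard basis vectors of `F^p`. -/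
def sigma1 : Matrix (Fin p) (Fin (p - q)) F :=
  Matrix.of fun i l => if i.val = q + l.val then 1 else 0

/-- The orthonormal basis of weight vectors. -/
def wtBasis : Matrix (Fin q ⊕ Fin p) (WIdx q p) F :=
  Matrix.fromCols
    (Matrix.fromRows ((Real.sqrt 2)⁻¹ • 1) ((Real.sqrt 2)⁻¹ • sigma0 F q p))
    (Matrix.fromCols
      (Matrix.fromRows ((Real.sqrt 2)⁻¹ • 1) (-((Real.sqrt 2)⁻¹ • sigma0 F q p)))
      (Matrix.fromRows 0 (sigma1 F q p)))

/-- The Hermitian form of signature `(q, p)`. -/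
def form : Mat F q p := Matrix.fromBlocks 1 0 0 (-1)

/-- The Hermitian form in the basis of weight vectors. -/
def wtForm : Matrix (WIdx q p) (WIdx q p) F :=
  Matrix.fromBlocks 0 (Matrix.fromCols 1 0) (Matrix.fromRows 1 0) (Matrix.fromBlocks 0 0 0 (-1))

/-- A diagonal matrix in the basis of weight vectors, with values depending on the weight. -/
def wtDiag (d : WIdx q p → ℝ) : Matrix (WIdx q p) (WIdx q p) F :=
  Matrix.diagonal fun a => algebraMap ℝ F (d a)

variable {F q p}

theorem sigma0_conj_mul_self (hqp : q ≤ p) : (sigma0 F q p)ᴴ * sigma0 F q p = 1 := by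
  ext i j
  rw [Matrix.mul_apply, Finset.sum_eq_single (Fin.castLE hqp i)]
  · simp [sigma0, Matrix.one_apply, Fin.ext_iff]
  · intro k _ hk
    have : ¬ (k.val = i.val) := fun h => hk (Fin.ext h)
    simp [sigma0, this]
  · simp

theorem sigma1_conj_mul_self (hqp : q ≤ p) : (sigma1 F q p)ᴴ * sigma1 F q p = 1 := by
  ext i j
  rw [Matrix.mul_apply, Finset.sum_eq_single ⟨q + i.val, by omega⟩]
  · simp [sigma1, Matrix.one_apply, Fin.ext_iff]
  · intro k _ hk
    have : ¬ (k.val = q + i.val) := fun h => hk (Fin.ext h)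
    simp [sigma1, this]
  · simp

theorem sigma0_conj_mul_sigma1 : (sigma0 F q p)ᴴ * sigma1 F q p = 0 := by
  ext i j
  rw [Matrix.mul_apply]
  refine Finset.sum_eq_zero fun k _ => ?_
  by_cases h : k.val = i.val
  · have : ¬ (k.val = q + j.val) := by omega
    simp [sigma1, this]
  · simp [sigma0, h]

theorem sigma1_conj_mul_sigma0 : (sigma1 F q p)ᴴ * sigma0 F q p = 0 := by
  rw [← Matrix.conjTranspose_conjTranspose (sigma0 F q p), ← Matrix.conjTranspose_mul,
    sigma0_conj_mul_sigma1, Matrix.conjTranspose_zero]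

theorem inv_sqrt_two_smul_add (n : Type) (M : Matrix n n F) :
    (Real.sqrt 2)⁻¹ • (Real.sqrt 2)⁻¹ • M + (Real.sqrt 2)⁻¹ • (Real.sqrt 2)⁻¹ • M = M := by
  rw [smul_smul, ← add_smul, ← mul_inv, Real.mul_self_sqrt (by norm_num)]
  norm_num

variable [StarModule ℝ F]

theorem wtBasis_conj_mul_self (hqp : q ≤ p) : (wtBasis F q p)ᴴ * wtBasis F q p = 1 := by
  simp only [wtBasis, Matrix.conjTranspose_fromCols_eq_fromRows_conjTranspose,
    Matrix.conjTranspose_fromRows_eq_fromCols_conjTranspose,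
    Matrix.fromRows_mul, Matrix.mul_fromCols, Matrix.fromCols_mul_fromRows,
    Matrix.conjTranspose_smul, Matrix.conjTranspose_neg, Matrix.conjTranspose_one, star_trivial,
    Matrix.smul_mul, Matrix.mul_smul, Matrix.neg_mul, Matrix.mul_neg,
    Matrix.mul_one, Matrix.conjTranspose_zero, Matrix.mul_zero,
    sigma0_conj_mul_self hqp, sigma1_conj_mul_self hqp, sigma0_conj_mul_sigma1,
    sigma1_conj_mul_sigma0, neg_neg, inv_sqrt_two_smul_add, smul_zero, smul_neg, neg_zero,
    add_zero, zero_add, add_neg_cancel]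
  rw [← Matrix.fromBlocks_one, ← Matrix.fromBlocks_one (l := Fin q)]
  ext (i | i | i) (j | j | j) <;> simp [Matrix.one_apply]

theorem wtBasis_mul_conj_self (hqp : q ≤ p) : wtBasis F q p * (wtBasis F q p)ᴴ = 1 := by
  -- Both index sets have `q + p` elements, so a left inverse is also a right inverse.
  have e : WIdx q p ≃ Fin q ⊕ Fin p :=
    Equiv.sumCongr (Equiv.refl _) (finSumFinEquiv.trans (finCongr (by omega)))
  exact (Matrix.mul_eq_one_comm_of_equiv e).mp (wtBasis_conj_mul_self hqp)

theorem form_mul_wtBasis : form F q p * wtBasis F q p = wtBasis F q p * wtForm F q p := by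
  simp only [wtBasis, form, wtForm, Matrix.mul_fromCols, Matrix.fromBlocks_mul_fromRows,
    Matrix.fromCols_mul_fromBlocks, Matrix.fromCols_mul_fromRows,
    Matrix.one_mul, Matrix.mul_one, Matrix.mul_zero, Matrix.zero_mul, add_zero, zero_add,
    Matrix.neg_mul, neg_neg, Matrix.mul_neg, neg_zero]
  ext (i | i) (j | j | j) <;> simp

/-- Since `σ₀* σ₀ = 1` and `σ₀* σ₁ = 0`, the columns `(e, ±σ₀ e)/√2` and `(0, σ₁ e)` are
eigenvectors of `H_s`. -/
theorem H_mul_wtBasis (hqp : q ≤ p) (s : Fin q → ℝ) : H F p s * wtBasis F q p =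
    wtBasis F q p * wtDiag F q p (wt s) := by
  have h : wtDiag F q p (wt s) =
      Matrix.fromBlocks (diagReal F s) 0 0 (Matrix.fromBlocks (-diagReal F s) 0 0 0) := by
    ext (i | i | i) (j | j | j) <;> simp [wt, wtDiag, diagReal, Matrix.diagonal_apply]
  rw [h]
  simp only [wtBasis, H, Matrix.mul_fromCols, Matrix.fromBlocks_mul_fromRows, Matrix.mul_assoc,
    Matrix.fromCols_mul_fromBlocks, Matrix.fromRows_mul,
    Matrix.one_mul, Matrix.mul_one, Matrix.mul_zero, Matrix.zero_mul, add_zero, zero_add,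
    Matrix.neg_mul, Matrix.mul_neg, Matrix.mul_smul, Matrix.smul_mul,
    sigma0_conj_mul_self hqp, sigma0_conj_mul_sigma1]
  ext (i | i) (j | j | j) <;> simp

/-- Transport of a matrix to the basis of weight vectors. -/
def toWt (X : Mat F q p) : Matrix (WIdx q p) (WIdx q p) F :=
  (wtBasis F q p)ᴴ * X * wtBasis F q p

/-- Transport of a matrix from the basis of weight vectors. -/
def ofWt (X : Matrix (WIdx q p) (WIdx q p) F) : Mat F q p :=
  wtBasis F q p * X * (wtBasis F q p)ᴴ

theorem wtBasis_mul_conj_mul (hqp : q ≤ p) {n : Type} (X : Matrix (Fin q ⊕ Fin p) n F) :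
    wtBasis F q p * ((wtBasis F q p)ᴴ * X) = X := by
  rw [← Matrix.mul_assoc, wtBasis_mul_conj_self hqp, Matrix.one_mul]

theorem wtBasis_conj_mul_mul (hqp : q ≤ p) {n : Type} (X : Matrix (WIdx q p) n F) :
    (wtBasis F q p)ᴴ * (wtBasis F q p * X) = X := by
  rw [← Matrix.mul_assoc, wtBasis_conj_mul_self hqp, Matrix.one_mul]

theorem ofWt_toWt (hqp : q ≤ p) (X : Mat F q p) : ofWt (toWt X) = X := by
  simp only [ofWt, toWt, Matrix.mul_assoc, wtBasis_mul_conj_mul hqp, wtBasis_mul_conj_self hqp,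
    Matrix.mul_one]

theorem toWt_ofWt (hqp : q ≤ p) (X : Matrix (WIdx q p) (WIdx q p) F) : toWt (ofWt X) = X := by
  simp only [ofWt, toWt, Matrix.mul_assoc, wtBasis_conj_mul_mul hqp, wtBasis_conj_mul_self hqp,
    Matrix.mul_one]

theorem toWt_mul (hqp : q ≤ p) (X Y : Mat F q p) : toWt (X * Y) = toWt X * toWt Y := by
  simp only [toWt, Matrix.mul_assoc, wtBasis_mul_conj_mul hqp]

theorem ofWt_mul (hqp : q ≤ p) (X Y : Matrix (WIdx q p) (WIdx q p) F) :
    ofWt (X * Y) = ofWt X * ofWt Y := by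
  simp only [ofWt, Matrix.mul_assoc, wtBasis_conj_mul_mul hqp]

theorem toWt_one (hqp : q ≤ p) : toWt (1 : Mat F q p) = 1 := by
  simp only [toWt, Matrix.mul_one, wtBasis_conj_mul_self hqp]

theorem ofWt_one (hqp : q ≤ p) : (ofWt 1 : Mat F q p) = 1 := by
  simp only [ofWt, Matrix.mul_one, wtBasis_mul_conj_self hqp]

theorem toWt_conjTranspose (X : Mat F q p) : toWt Xᴴ = (toWt X)ᴴ := by
  simp only [toWt, Matrix.conjTranspose_mul, Matrix.conjTranspose_conjTranspose, Matrix.mul_assoc]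

theorem ofWt_conjTranspose (X : Matrix (WIdx q p) (WIdx q p) F) : ofWt Xᴴ = (ofWt X)ᴴ := by
  simp only [ofWt, Matrix.conjTranspose_mul, Matrix.conjTranspose_conjTranspose, Matrix.mul_assoc]

theorem toWt_form (hqp : q ≤ p) : toWt (form F q p) = wtForm F q p := by
  rw [toWt, Matrix.mul_assoc, form_mul_wtBasis, wtBasis_conj_mul_mul hqp]

theorem ofWt_wtForm (hqp : q ≤ p) : ofWt (wtForm F q p) = form F q p := by
  rw [← toWt_form hqp, ofWt_toWt hqp]

theorem toWt_H (hqp : q ≤ p) (s : Fin q → ℝ) : toWt (H F p s) = wtDiag F q p (wt s) := by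
  rw [toWt, Matrix.mul_assoc, H_mul_wtBasis hqp, wtBasis_conj_mul_mul hqp]

theorem wtForm_mul_self : wtForm F q p * wtForm F q p = 1 := by
  simp only [wtForm, Matrix.fromBlocks_multiply, Matrix.fromCols_mul_fromRows,
    Matrix.fromRows_mul_fromCols]
  rw [← Matrix.fromBlocks_one, ← Matrix.fromBlocks_one (l := Fin q)]
  ext (i | i | i) (j | j | j) <;> simp [Matrix.one_apply, Matrix.mul_apply, Fintype.sum_sum_type]

theorem wtForm_conjTranspose : (wtForm F q p)ᴴ = wtForm F q p := by
  ext (i | i | i) (j | j | j) <;> simp [wtForm, Matrix.one_apply, eq_comm, apply_ite]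

/-- The sign by which the Hermitian form acts on a weight vector. -/
def flipSign : WIdx q p → F := Sum.elim (fun _ => 1) (Sum.elim (fun _ => 1) fun _ => -1)

theorem wtForm_apply (a b : WIdx q p) :
    wtForm F q p a b = if b = flipIdx a then flipSign a else 0 := by
  rcases a with i | i | i <;> rcases b with j | j | j <;>
    simp [wtForm, flipIdx, flipSign, Matrix.one_apply, eq_comm, apply_ite]

theorem wtForm_mul_apply (X : Matrix (WIdx q p) (WIdx q p) F) (a b : WIdx q p) :
    (wtForm F q p * X) a b = flipSign a * X (flipIdx a) b := by
  simp [Matrix.mul_apply, wtForm_apply]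

theorem flipIdx_flipIdx (a : WIdx q p) : flipIdx (flipIdx a) = a := by
  rcases a with i | i | i <;> rfl

theorem flipSign_flipIdx (a : WIdx q p) : (flipSign (flipIdx a) : F) = flipSign a := by
  rcases a with i | i | i <;> rfl

theorem mul_wtForm_apply (X : Matrix (WIdx q p) (WIdx q p) F) (a b : WIdx q p) :
    (X * wtForm F q p) a b = X a (flipIdx b) * flipSign b := by
  rw [Matrix.mul_apply, Finset.sum_eq_single (flipIdx b)]
  · simp [wtForm_apply, flipIdx_flipIdx, flipSign_flipIdx]
  · intro k _ hk
    have : b ≠ flipIdx k := fun h => hk (by rw [h, flipIdx_flipIdx])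
    simp [wtForm_apply, this]
  · simp

end WeightBasis

/-- The laws of the scalars that make the Lie algebra `𝔤` invariant. -/
class LawfulScalars (F : Type) [NormedDivisionRing F] [NormedAlgebra ℝ F] [StarRing F]
    [Scalars F] : Prop extends NormStar F where
  redTrace_mul_comm : ∀ a b : F, Scalars.redTrace (a * b) = Scalars.redTrace (b * a)

/-! ### The exponential in the weight basis. -/

section Exponential

variable {F : Type} [NormedDivisionRing F] [NormedAlgebra ℝ F] [StarRing F] [StarModule ℝ F]
variable {q p : ℕ}

/-- Conjugation by the weight basis is multiplicative and a linear homeomorphism. The latter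
commutes with `tsum` even without summability, so completeness is not required. -/
theorem toWt_exp (hqp : q ≤ p) (X : Mat F q p) :
    toWt (NormedSpace.exp X) = NormedSpace.exp (toWt X) := by
  have : CharZero F := charZero_of_injective_algebraMap (algebraMap ℝ F).injective
  let e : Mat F q p ≃L[ℝ] Matrix (WIdx q p) (WIdx q p) F :=
    { toFun := toWt
      invFun := ofWt
      left_inv := ofWt_toWt hqp
      right_inv := toWt_ofWt hqp
      map_add' := fun X Y => by simp [toWt, Matrix.mul_add, Matrix.add_mul]
      map_smul' := fun c X => by simp [toWt]
      continuous_toFun := by unfold toWt; fun_prop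
      continuous_invFun := by unfold ofWt; fun_prop }
  have hpow : ∀ k : ℕ, e (X ^ k) = (e X) ^ k := by
    intro k
    induction k with
    | zero =>
      rw [pow_zero, pow_zero]
      exact toWt_one hqp
    | succ k ih =>
      rw [pow_succ, pow_succ, ← ih]
      exact toWt_mul hqp _ _
  change e _ = NormedSpace.exp (e X)
  rw [NormedSpace.exp_eq_tsum ℝ, NormedSpace.exp_eq_tsum ℝ]
  simp only
  rw [e.map_tsum]
  simp only [map_smul, hpow]

theorem exp_wtDiag [CompleteSpace F] (d : WIdx q p → ℝ) :
    NormedSpace.exp (wtDiag F q p d) = wtDiag F q p fun a => Real.exp (d a) := by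
  have : CharZero F := charZero_of_injective_algebraMap (algebraMap ℝ F).injective
  rw [wtDiag, Matrix.exp_diagonal, wtDiag]
  congr 1
  ext a
  rw [Pi.coe_exp, Real.exp_eq_exp_ℝ, NormedSpace.algebraMap_exp_comm]

theorem toWt_a [CompleteSpace F] (hqp : q ≤ p) (s : Fin q → ℝ) :
    toWt (a F p s) = wtDiag F q p fun a => Real.exp (wt s a) := by
  rw [a, toWt_exp hqp, toWt_H hqp, exp_wtDiag]

end Exponential

/-! ### `N` as the unipotent triangular matrices that preserve the form. -/

section NilpotentGroup

variable {F : Type} [NormedDivisionRing F] [NormedAlgebra ℝ F] [StarRing F] [StarModule ℝ F]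
variable [Scalars F] {q p : ℕ}

theorem wtDiag_mul_apply (d : WIdx q p → ℝ) (X : Matrix (WIdx q p) (WIdx q p) F)
    (i j : WIdx q p) : (wtDiag F q p d * X) i j = d i • X i j := by
  rw [wtDiag, Matrix.diagonal_mul, Algebra.smul_def]

theorem mul_wtDiag_apply (d : WIdx q p → ℝ) (X : Matrix (WIdx q p) (WIdx q p) F)
    (i j : WIdx q p) : (X * wtDiag F q p d) i j = d j • X i j := by
  rw [wtDiag, Matrix.mul_diagonal, ← Algebra.commutes, Algebra.smul_def]

/-- Bracketing a root vector for `α` with the dominant regular element multiplies its entry `(i, j)`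
by `lvl j - lvl i` and also by the positive number `α(domReg)`. So the entry vanishes unless `lvl i
< lvl j`. -/
theorem strictUpper_toWt_of_mem_nilAlg (hqp : q ≤ p) {X : Mat F q p} (hX : X ∈ nilAlg F q p) :
    StrictUpper lvl (toWt X) := by
  let S : Submodule ℝ (Mat F q p) :=
    { carrier := {X | StrictUpper lvl (toWt X)}
      zero_mem' := fun i j _ => by simp [toWt]
      add_mem' := fun {X Y} hX hY i j h => by
        have : toWt (X + Y) = toWt X + toWt Y := by simp [toWt, Matrix.mul_add, Matrix.add_mul]
        rw [this, Matrix.add_apply, hX i j h, hY i j h, add_zero]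
      smul_mem' := fun c X hX i j h => by
        have : toWt (c • X) = c • toWt X := by simp [toWt]
        rw [this, Matrix.smul_apply, hX i j h, smul_zero] }
  have hS : nilAlg F q p ≤ S := by
    refine iSup₂_le fun α hα X hX i j hij => ?_
    have h := hX.2 (domReg q)
    have h' : toWt (H F p (domReg q)) * toWt X - toWt X * toWt (H F p (domReg q)) =
        (∑ i, α i * domReg q i) • toWt X := by
      rw [← toWt_mul hqp, ← toWt_mul hqp]
      have : ∀ Y Z : Mat F q p, toWt Y - toWt Z = toWt (Y - Z) := fun Y Z => by
        simp [toWt, Matrix.mul_sub, Matrix.sub_mul]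
      rw [this, h]
      simp [toWt]
    have h2 := congrFun (congrFun h' i) j
    rw [toWt_H hqp, Matrix.sub_apply, wtDiag_mul_apply, mul_wtDiag_apply, Matrix.smul_apply,
      ← sub_smul, ← sub_eq_zero, ← sub_smul, wt_domReg, wt_domReg] at h2
    have hpos := posRoots_domReg_pos hα
    refine (smul_eq_zero.mp h2).resolve_left (ne_of_lt ?_)
    have : (lvl j : ℝ) ≤ lvl i := by exact_mod_cast hij
    linarith
  exact hS hX

theorem strictUpper_of_mem_N (hqp : q ≤ p) {n : Mat F q p} (hn : n ∈ N F q p) :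
    StrictUpper lvl (toWt n - 1) := by
  have : CharZero F := charZero_of_injective_algebraMap (algebraMap ℝ F).injective
  obtain ⟨X, hX, rfl⟩ := hn
  rw [toWt_exp hqp]
  exact (strictUpper_toWt_of_mem_nilAlg hqp hX).exp_sub_one

theorem mem_lieAlg_of_form {X : Mat F q p} (h : form F q p * Xᴴ * form F q p = -X)
    (ht : Scalars.redTrace X.trace = 0) : X ∈ lieAlg F q p := by
  rw [← Matrix.fromBlocks_toBlocks X, Matrix.fromBlocks_conjTranspose] at h
  simp only [form, Matrix.fromBlocks_multiply, Matrix.fromBlocks_neg, Matrix.one_mul,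
    Matrix.mul_one, Matrix.mul_zero, Matrix.zero_mul, add_zero, zero_add, Matrix.neg_mul,
    Matrix.mul_neg, neg_neg] at h
  obtain ⟨h1, h2, h3, h4⟩ := Matrix.fromBlocks_inj.mp h
  refine ⟨h1, h4, ?_, ?_⟩
  · exact (neg_injective h3).symm
  · rw [Matrix.trace, Fintype.sum_sum_type] at ht
    exact ht

/-- Over `ℍ` the trace itself is not invariant under conjugation; its projection along commutators
is. -/
theorem redTrace_trace_mul_comm [LawfulScalars F] {m n : Type} [Fintype m] [Fintype n]
    (X : Matrix m n F) (Y : Matrix n m F) :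
    Scalars.redTrace (X * Y).trace = Scalars.redTrace (Y * X).trace := by
  simp only [Matrix.trace, Matrix.diag_apply, Matrix.mul_apply, map_sum]
  rw [Finset.sum_comm]
  simp only [LawfulScalars.redTrace_mul_comm]

theorem ofWt_mem_rootSpace [LawfulScalars F] (hqp : q ≤ p) {Z : Matrix (WIdx q p) (WIdx q p) F}
    (hZ : wtForm F q p * Zᴴ * wtForm F q p = -Z) {α : Fin q → ℝ} (hα : α ≠ 0)
    (h : ∀ i j, Z i j ≠ 0 → wtCoeff i - wtCoeff j = α) : ofWt Z ∈ rootSpace F q p α := by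
  refine ⟨mem_lieAlg_of_form ?_ ?_, fun s => ?_⟩
  · rw [← ofWt_wtForm hqp, ← ofWt_conjTranspose, ← ofWt_mul hqp, ← ofWt_mul hqp, hZ]
    simp [ofWt]
  · rw [ofWt, redTrace_trace_mul_comm, wtBasis_conj_mul_mul hqp, Matrix.trace,
      Finset.sum_eq_zero, map_zero]
    intro i _
    by_contra h0
    exact hα (by rw [← h i i h0, sub_self])
  · have hH : H F p s = ofWt (wtDiag F q p (wt s)) := by rw [← toWt_H hqp, ofWt_toWt hqp]
    have hsub : ∀ Y Z : Matrix (WIdx q p) (WIdx q p) F, ofWt Y - ofWt Z = ofWt (Y - Z) :=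
      fun Y Z => by simp [ofWt, Matrix.mul_sub, Matrix.sub_mul]
    have hsmul : ∀ (c : ℝ) (Z : Matrix (WIdx q p) (WIdx q p) F), c • ofWt Z = ofWt (c • Z) :=
      fun c Z => by simp [ofWt]
    rw [hH, ← ofWt_mul hqp, ← ofWt_mul hqp, hsub, hsmul]
    congr 1
    ext i j
    rw [Matrix.sub_apply, wtDiag_mul_apply, mul_wtDiag_apply, ← sub_smul, Matrix.smul_apply]
    by_cases h0 : Z i j = 0
    · rw [h0, smul_zero, smul_zero]
    · rw [wt_eq_sum, wt_eq_sum, ← Finset.sum_sub_distrib, ← h i j h0]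
      simp only [← sub_mul, Pi.sub_apply]

theorem wtCoeff_flipIdx (i : WIdx q p) : wtCoeff (flipIdx i) = -wtCoeff i := by
  rcases i with i | i | i <;> simp [wtCoeff, flipIdx]

theorem flipSign_mul_self (i : WIdx q p) : (flipSign i : F) * flipSign i = 1 := by
  rcases i with i | i | i <;> simp [flipSign]

theorem ofWt_mem_nilAlg [LawfulScalars F] (hqp : q ≤ p) {X : Matrix (WIdx q p) (WIdx q p) F}
    (hX : StrictUpper lvl X) (hX' : wtForm F q p * Xᴴ * wtForm F q p = -X) :
    ofWt X ∈ nilAlg F q p := by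
  -- A single entry of `X` need not lie in the Lie algebra; subtracting its image under `Z ↦ J Z* J`
  -- repairs this. The image sits at `(flip j, flip i)`, where the difference of weights is the
  -- same, so the result lies in one root space. As `J X* J = -X`, the sum counts `X` twice.
  let T : WIdx q p → WIdx q p → Matrix (WIdx q p) (WIdx q p) F := fun i j =>
    Matrix.single i j (X i j) -
      wtForm F q p * (Matrix.single i j (X i j))ᴴ * wtForm F q p
  have hsum : X = (1 / 2 : ℝ) • ∑ i, ∑ j, T i j := by
    have h1 : ∑ i, ∑ j, T i j = X - wtForm F q p * Xᴴ * wtForm F q p := by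
      simp only [T, Finset.sum_sub_distrib, ← Finset.sum_mul, ← Finset.mul_sum,
        ← Matrix.conjTranspose_sum, ← Matrix.matrix_eq_sum_single]
    rw [h1, hX', sub_neg_eq_add, ← two_smul ℝ X, smul_smul]
    norm_num
  have hT : ∀ i j, ofWt (T i j) ∈ nilAlg F q p := by
    intro i j
    by_cases hij : lvl j ≤ lvl i
    · have : T i j = 0 := by simp [T, hX i j hij]
      rw [this]
      simp [ofWt]
    · have hα := wtCoeff_sub_mem_posRoots (not_le.mp hij)
      refine Submodule.mem_iSup_of_mem _ (Submodule.mem_iSup_of_mem hα ?_)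
      refine ofWt_mem_rootSpace hqp ?_ ?_ ?_
      · simp only [T]
        rw [Matrix.conjTranspose_sub, Matrix.conjTranspose_mul, Matrix.conjTranspose_mul,
          wtForm_conjTranspose, Matrix.conjTranspose_conjTranspose, Matrix.mul_sub,
          Matrix.sub_mul]
        have : wtForm F q p * (wtForm F q p * (Matrix.single i j (X i j) * wtForm F q p)) *
            wtForm F q p = Matrix.single i j (X i j) := by
          rw [Matrix.mul_assoc, Matrix.mul_assoc, Matrix.mul_assoc, wtForm_mul_self,
            Matrix.mul_one, ← Matrix.mul_assoc, wtForm_mul_self, Matrix.one_mul]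
        rw [this, neg_sub]
      · intro h0
        have := posRoots_domReg_pos hα
        rw [h0] at this
        simp at this
      · intro c d hcd
        by_contra hne
        apply hcd
        simp only [T]
        rw [Matrix.sub_apply, mul_wtForm_apply, wtForm_mul_apply, Matrix.conjTranspose_apply,
          Matrix.single_apply_of_ne, Matrix.single_apply_of_ne]
        · simp
        · rintro ⟨h1, h2⟩
          apply hne
          rw [h1, h2, wtCoeff_flipIdx, wtCoeff_flipIdx]
          abel
        · rintro ⟨rfl, rfl⟩
          exact hne rfl
  have hlin : ofWt X = (1 / 2 : ℝ) • ∑ i, ∑ j, ofWt (T i j) := by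
    conv_lhs => rw [hsum]
    simp only [ofWt, Matrix.mul_smul, Matrix.smul_mul, Matrix.mul_sum, Matrix.sum_mul]
  rw [hlin]
  exact Submodule.smul_mem _ _
    (Submodule.sum_mem _ fun i _ => Submodule.sum_mem _ fun j _ => hT i j)

theorem ofWt_mem_N [LawfulScalars F] (hqp : q ≤ p) {n : Matrix (WIdx q p) (WIdx q p) F}
    (hn : StrictUpper lvl (n - 1)) (hn' : n * (wtForm F q p * nᴴ * wtForm F q p) = 1) :
    ofWt n ∈ N F q p := by
  have : CharZero F := charZero_of_injective_algebraMap (algebraMap ℝ F).injective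
  obtain ⟨X, h1, h2, h3⟩ := exists_strictUpper_exp_eq wtForm_mul_self wtForm_conjTranspose hn hn'
  refine ⟨ofWt X, ofWt_mem_nilAlg hqp h1 h2, ?_⟩
  rw [← ofWt_toWt hqp (NormedSpace.exp (ofWt X)), toWt_exp hqp, toWt_ofWt hqp, h3]

end NilpotentGroup

/-! ### Positive matrices with square one. -/

section PositiveInvolution

variable {F : Type} [NormedDivisionRing F] [NormedAlgebra ℝ F] [StarRing F] [NormStar F]

theorem mul_conjTranspose_self_apply {m n : Type} [Fintype n] (S : Matrix m n F) (i : m) :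
    (S * Sᴴ) i i = algebraMap ℝ F (∑ j, ‖S i j‖ ^ 2) := by
  simp [Matrix.mul_apply, self_mul_star_eq]

/-- A positive matrix of the form `S S*` whose square is `1` is `1`. -/
theorem mul_conjTranspose_self_eq_one {m n : Type} [Fintype m] [Fintype n] [DecidableEq m]
    {S : Matrix m n F} (h : (S * Sᴴ) * (S * Sᴴ) = 1) : S * Sᴴ = 1 := by
  set D := S * Sᴴ - 1 with hD
  have hDs : Dᴴ = D := by simp [hD]
  -- From `D (S S* + 1) = 0`, multiplication by `D` gives two positive semidefinite matrices with
  -- sum zero. Their diagonals are sums of squared norms, which forces `D = 0`.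
  have h1 : (D * S) * (D * S)ᴴ + D * Dᴴ = 0 := by
    have : D * (S * Sᴴ + 1) = 0 := by
      rw [hD, sub_mul, mul_add, h, Matrix.mul_one, one_mul, add_comm, sub_self]
    calc (D * S) * (D * S)ᴴ + D * Dᴴ = D * (S * Sᴴ + 1) * D := by
          rw [Matrix.conjTranspose_mul, hDs, mul_add, add_mul]
          simp only [Matrix.mul_assoc, Matrix.mul_one]
      _ = 0 := by rw [this, Matrix.zero_mul]
  have h2 : D = 0 := by
    ext i j
    have h3 := congrFun (congrFun h1 i) i
    rw [Matrix.add_apply, mul_conjTranspose_self_apply, mul_conjTranspose_self_apply, ← map_add,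
      Matrix.zero_apply, map_eq_zero] at h3
    have h4 : 0 ≤ ∑ j, ‖(D * S) i j‖ ^ 2 := Finset.sum_nonneg fun _ _ => by positivity
    have h5 : ‖D i j‖ ^ 2 ≤ ∑ j, ‖D i j‖ ^ 2 :=
      Finset.single_le_sum (f := fun j => ‖D i j‖ ^ 2) (fun _ _ => by positivity)
        (Finset.mem_univ j)
    have h6 : ‖D i j‖ ^ 2 ≤ 0 := by linarith
    simpa using pow_eq_zero_iff two_ne_zero |>.mp (le_antisymm h6 (by positivity))
  rw [← sub_eq_zero, ← hD, h2]

end PositiveInvolution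

/-! ### Existence of the Iwasawa decomposition. -/

section Iwasawa

variable {F : Type} [NormedDivisionRing F] [NormedAlgebra ℝ F] [StarRing F] [StarModule ℝ F]
variable [Scalars F] [LawfulScalars F] {q p : ℕ}

theorem form_conj_apply (R : Matrix (WIdx q p) (WIdx q p) F) (i j : WIdx q p) :
    (wtForm F q p * Rᴴ * wtForm F q p) i j =
      flipSign i * star (R (flipIdx j) (flipIdx i)) * flipSign j := by
  rw [mul_wtForm_apply, wtForm_mul_apply, Matrix.conjTranspose_apply]

/-- The conjugate transpose reverses the order of the levels, and the form reverses it back. -/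
theorem form_conj_blockTriangular {R : Matrix (WIdx q p) (WIdx q p) F}
    (hR : R.BlockTriangular lvl) :
    (wtForm F q p * Rᴴ * wtForm F q p).BlockTriangular lvl := by
  intro i j hij
  rw [form_conj_apply, hR (by rw [lvl_flipIdx, lvl_flipIdx]; exact neg_lt_neg hij)]
  simp

theorem lvl_eq {i j : WIdx q p} (h : lvl i = lvl j) :
    i = j ∨ ∃ l l', i = Sum.inr (Sum.inr l) ∧ j = Sum.inr (Sum.inr l') := by
  rcases i with i | i | i <;> rcases j with j | j | j <;> simp [lvl] at h <;>
    simp [Fin.ext_iff] <;> omega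

theorem form_conj_mul (X Y : Matrix (WIdx q p) (WIdx q p) F) :
    wtForm F q p * (X * Y)ᴴ * wtForm F q p =
      (wtForm F q p * Yᴴ * wtForm F q p) * (wtForm F q p * Xᴴ * wtForm F q p) := by
  rw [Matrix.conjTranspose_mul]
  calc wtForm F q p * (Yᴴ * Xᴴ) * wtForm F q p
      = wtForm F q p * Yᴴ * 1 * Xᴴ * wtForm F q p := by simp only [Matrix.mul_assoc, Matrix.mul_one]
    _ = _ := by rw [← wtForm_mul_self]; simp only [Matrix.mul_assoc]

/-- The factor `R` in the `QR` decomposition of a matrix preserving the Hermitian form preserves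
the form as well; moreover its middle diagonal block is `1`. -/
theorem qr_factor_preserves_form (hqp : q ≤ p) {V R R' : Matrix (WIdx q p) (WIdx q p) F}
    (hV : Vᴴ * V = 1) (hR' : R' * R = 1) (hRt : ∀ i j, fineLvl j < fineLvl i → R i j = 0)
    (hRt' : ∀ i j, fineLvl j < fineLvl i → R' i j = 0) {r : WIdx q p → ℝ}
    (hr : ∀ i, 0 < r i ∧ R i i = algebraMap ℝ F (r i))
    (hG : (V * R) * (wtForm F q p * (V * R)ᴴ * wtForm F q p) = 1) :
    R * (wtForm F q p * Rᴴ * wtForm F q p) = 1 ∧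
      (∀ l l', R (Sum.inr (Sum.inr l)) (Sum.inr (Sum.inr l')) = (1 : Matrix _ _ F) l l') ∧
      ∀ i, r i * r (flipIdx i) = 1 := by
  set J := wtForm F q p with hJdef
  have hJ : J * J = 1 := wtForm_mul_self
  have hJs : Jᴴ = J := wtForm_conjTranspose
  have hRR' : R * R' = 1 := mul_eq_one_comm.mp hR'
  have hVV : V * Vᴴ = 1 := mul_eq_one_comm.mp hV
  have hRb : R.BlockTriangular lvl := fun i j hij => hRt i j (fineLvl_lt hqp hij)
  have hRb' : R'.BlockTriangular lvl := fun i j hij => hRt' i j (fineLvl_lt hqp hij)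
  set L := R * (J * Rᴴ * J) with hL
  -- The aim is `L = 1`. Here `L` is block triangular as a product of two such matrices, and unitary
  -- because it is a product of the unitary matrices `V*`, `J`, `V`, `J`.
  have hLM : L = Vᴴ * J * V * J := by
    symm
    calc Vᴴ * J * V * J = Vᴴ * (V * R * (J * (V * R)ᴴ * J)) * (J * V * J) := by
          rw [hG, Matrix.mul_one]; simp only [Matrix.mul_assoc]
      _ = (Vᴴ * V) * R * J * Rᴴ * Vᴴ * (J * J) * V * J := by
          rw [Matrix.conjTranspose_mul]; simp only [Matrix.mul_assoc]
      _ = R * J * Rᴴ * Vᴴ * V * J := by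
          rw [hJ, hV, Matrix.mul_one, Matrix.one_mul]
      _ = R * J * Rᴴ * (Vᴴ * V) * J := by simp only [Matrix.mul_assoc]
      _ = L := by rw [hV, Matrix.mul_one, hL]; simp only [Matrix.mul_assoc]
  have hLL : L * Lᴴ = 1 := by
    rw [hLM]
    simp only [Matrix.conjTranspose_mul, Matrix.conjTranspose_conjTranspose, hJs]
    calc Vᴴ * J * V * J * (J * (Vᴴ * (J * V))) = Vᴴ * J * V * (J * J) * Vᴴ * J * V := by
          simp only [Matrix.mul_assoc]
      _ = Vᴴ * J * (V * Vᴴ) * J * V := by rw [hJ]; simp only [Matrix.mul_assoc, Matrix.one_mul]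
      _ = Vᴴ * (J * J) * V := by rw [hVV, Matrix.mul_one]; simp only [Matrix.mul_assoc]
      _ = 1 := by rw [hJ, Matrix.mul_one, hV]
  have hLb : L.BlockTriangular lvl := hRb.mul (form_conj_blockTriangular hRb)
  have hLinv : Lᴴ = (J * R'ᴴ * J) * R' := by
    have h1 : L * ((J * R'ᴴ * J) * R') = 1 := by
      rw [hL]
      calc R * (J * Rᴴ * J) * (J * R'ᴴ * J * R')
          = R * ((J * Rᴴ * J) * (J * R'ᴴ * J)) * R' := by simp only [Matrix.mul_assoc]
        _ = R * (J * (R' * R)ᴴ * J) * R' := by rw [hJdef, ← form_conj_mul]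
        _ = 1 := by rw [hR', Matrix.conjTranspose_one, Matrix.mul_one, hJ, Matrix.mul_one, hRR']
    calc Lᴴ = Lᴴ * (L * ((J * R'ᴴ * J) * R')) := by rw [h1, Matrix.mul_one]
      _ = (Lᴴ * L) * ((J * R'ᴴ * J) * R') := by simp only [Matrix.mul_assoc]
      _ = _ := by rw [mul_eq_one_comm.mp hLL, Matrix.one_mul]
  have hLb' : (Lᴴ).BlockTriangular lvl := by
    rw [hLinv]
    exact (form_conj_blockTriangular hRb').mul hRb'
  -- Since `L* = L⁻¹` is block triangular as well, `L` is block diagonal. Its blocks are single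
  -- entries, except for the zero weight block.
  have hLoff : ∀ i j, lvl i ≠ lvl j → L i j = 0 := by
    intro i j hij
    rcases lt_or_gt_of_ne hij with h | h
    · have := hLb' h
      rwa [Matrix.conjTranspose_apply, star_eq_zero] at this
    · exact hLb h
  set S : Matrix (Fin (p - q)) (Fin (p - q)) F :=
    fun l l' => R (Sum.inr (Sum.inr l)) (Sum.inr (Sum.inr l')) with hS
  have hlvl0 : ∀ l : Fin (p - q), lvl (Sum.inr (Sum.inr l) : WIdx q p) = 0 := fun _ => rfl
  have hlvln : ∀ i : Fin q, lvl (Sum.inl i : WIdx q p) < 0 := fun i => by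
    simp [lvl]
  have hlvlp : ∀ i : Fin q, 0 < lvl (Sum.inr (Sum.inl i) : WIdx q p) := fun i => by
    simp [lvl]
  -- On the zero weights the form is `-1` and the two signs cancel; by triangularity the other
  -- weights do not contribute.
  have hL0 : ∀ l l', L (Sum.inr (Sum.inr l)) (Sum.inr (Sum.inr l')) = (S * Sᴴ) l l' := by
    intro l l'
    rw [hL, Matrix.mul_apply, Fintype.sum_sum_type, Fintype.sum_sum_type, Matrix.mul_apply]
    rw [Finset.sum_eq_zero, Finset.sum_eq_zero (s := (Finset.univ : Finset (Fin q))), zero_add,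
      zero_add]
    · refine Finset.sum_congr rfl fun k _ => ?_
      rw [form_conj_apply, Matrix.conjTranspose_apply]
      simp [flipSign, flipIdx, hS]
    · intro i _
      rw [form_conj_blockTriangular hRb (by rw [hlvl0]; exact hlvlp i), mul_zero]
    · intro i _
      rw [hRb (by rw [hlvl0]; exact hlvln i), zero_mul]
  have hSS : S * Sᴴ = 1 := by
    refine mul_conjTranspose_self_eq_one ?_
    ext l l'
    have h1 := congrFun (congrFun hLL (Sum.inr (Sum.inr l))) (Sum.inr (Sum.inr l'))
    rw [Matrix.mul_apply, Fintype.sum_sum_type, Fintype.sum_sum_type] at h1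
    rw [Finset.sum_eq_zero, Finset.sum_eq_zero (s := (Finset.univ : Finset (Fin q))), zero_add,
      zero_add] at h1
    · rw [Matrix.mul_apply]
      have hsymm : ∀ k, (S * Sᴴ) k l' = star ((S * Sᴴ) l' k) := by
        intro k
        rw [← Matrix.conjTranspose_apply, Matrix.conjTranspose_mul,
          Matrix.conjTranspose_conjTranspose]
      simp only [Matrix.conjTranspose_apply, hL0] at h1
      simp only [hsymm _, h1]
      simp [Matrix.one_apply]
    · intro i _
      rw [hLoff _ _ (by rw [hlvl0]; exact (hlvlp i).ne), zero_mul]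
    · intro i _
      rw [hLoff _ _ (by rw [hlvl0]; exact (hlvln i).ne'), zero_mul]
  -- Now `S` is unitary and upper triangular with upper triangular inverse `S*`, hence diagonal; its
  -- diagonal entries are positive of norm one.
  have hS1 : S = 1 := by
    set S' : Matrix (Fin (p - q)) (Fin (p - q)) F :=
      fun l l' => R' (Sum.inr (Sum.inr l)) (Sum.inr (Sum.inr l')) with hS'
    have h1 : S' * S = 1 := by
      ext l l'
      have h1 := congrFun (congrFun hR' (Sum.inr (Sum.inr l))) (Sum.inr (Sum.inr l'))
      rw [Matrix.mul_apply, Fintype.sum_sum_type, Fintype.sum_sum_type] at h1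
      rw [Finset.sum_eq_zero, Finset.sum_eq_zero (s := (Finset.univ : Finset (Fin q))), zero_add,
        zero_add] at h1
      · rw [Matrix.mul_apply]
        simp only [hS, hS', h1]
        simp [Matrix.one_apply]
      · intro i _
        rw [hRb (by rw [hlvl0]; exact hlvlp i), mul_zero]
      · intro i _
        rw [hRb' (by rw [hlvl0]; exact hlvln i), zero_mul]
    have h2 : S' = Sᴴ := by
      rw [← Matrix.mul_one S', ← hSS, ← Matrix.mul_assoc, h1, Matrix.one_mul]
    have h3 : ∀ l l', l' < l → S l l' = 0 := fun l l' h => hRt _ _ (by simpa [fineLvl] using h)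
    have h4 : ∀ l l', l < l' → S l l' = 0 := fun l l' h => by
      have : S' l' l = 0 := hRt' _ _ (by simpa [fineLvl] using h)
      rw [h2, Matrix.conjTranspose_apply, star_eq_zero] at this
      exact this
    ext l l'
    rcases lt_trichotomy l l' with h | rfl | h
    · rw [h4 _ _ h, Matrix.one_apply_ne h.ne]
    · obtain ⟨h5, h6⟩ := hr (Sum.inr (Sum.inr l))
      have h7 := congrFun (congrFun hSS l) l
      rw [Matrix.mul_apply, Finset.sum_eq_single l, Matrix.one_apply_eq, Matrix.conjTranspose_apply]
        at h7
      · change R _ _ * star (R _ _) = 1 at h7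
        rw [h6, star_algebraMap_real, ← map_mul, ← map_one (algebraMap ℝ F)] at h7
        have h8 := algebraMap_real_injective h7
        have h9 : r (Sum.inr (Sum.inr l)) = 1 := by nlinarith
        change R _ _ = _
        rw [h6, h9, map_one, Matrix.one_apply_eq]
      · intro k _ hk
        rcases lt_or_gt_of_ne hk with h | h
        · rw [h3 _ _ h, zero_mul]
        · rw [h4 _ _ h, zero_mul]
      · simp
    · rw [h3 _ _ h, Matrix.one_apply_ne h.ne']
  have hLd : ∀ i, (∀ j, lvl i = lvl j → i = j) → L i i = algebraMap ℝ F (r i * r (flipIdx i)) := by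
    intro i hi
    rw [hL, Matrix.mul_apply, Finset.sum_eq_single i]
    · rw [form_conj_apply, (hr i).2, (hr (flipIdx i)).2, star_algebraMap_real,
        ← Algebra.commutes, mul_assoc, flipSign_mul_self, mul_one, map_mul]
    · intro k _ hk
      rcases lt_or_gt_of_ne (fun h => hk (hi k h.symm).symm : lvl k ≠ lvl i) with h | h
      · rw [hRb h, zero_mul]
      · rw [form_conj_blockTriangular hRb h, mul_zero]
    · simp
  -- On a block of size one, unitarity says that the square of the positive number `r i * r (flipIdx
  -- i)` is `1`.
  have hrr : ∀ i, (∀ j, lvl i = lvl j → i = j) → r i * r (flipIdx i) = 1 := by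
    intro i hi
    have h7 := congrFun (congrFun hLL i) i
    rw [Matrix.mul_apply, Finset.sum_eq_single i, Matrix.one_apply_eq, Matrix.conjTranspose_apply,
      hLd i hi, star_algebraMap_real, ← map_mul, ← map_one (algebraMap ℝ F)] at h7
    · have h8 := algebraMap_real_injective h7
      have h9 := mul_pos (hr i).1 (hr (flipIdx i)).1
      nlinarith
    · intro k _ hk
      rw [hLoff i k (fun h => hk (hi k h).symm), zero_mul]
    · simp
  have hcase : ∀ i : WIdx q p, (∀ j, lvl i = lvl j → i = j) ∨ ∃ l, i = Sum.inr (Sum.inr l) := by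
    rintro (i | i | i)
    · left
      intro j hj
      rcases lvl_eq hj with h | ⟨l, l', h, -⟩
      · exact h
      · simp at h
    · left
      intro j hj
      rcases lvl_eq hj with h | ⟨l, l', h, -⟩
      · exact h
      · simp at h
    · exact Or.inr ⟨i, rfl⟩
  refine ⟨?_, fun l l' => congrFun (congrFun hS1 l) l', fun i => ?_⟩
  · ext i j
    by_cases hij : lvl i = lvl j
    · rcases lvl_eq hij with rfl | ⟨l, l', rfl, rfl⟩
      · rcases hcase i with hi | ⟨l, rfl⟩
        · rw [hLd i hi, hrr i hi, map_one, Matrix.one_apply_eq]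
        · rw [hL0, hSS, Matrix.one_apply_eq, Matrix.one_apply_eq]
      · rw [hL0, hSS]
        simp [Matrix.one_apply]
    · rw [hLoff i j hij, Matrix.one_apply_ne (fun h => hij (by rw [h]))]
  · rcases hcase i with hi | ⟨l, rfl⟩
    · exact hrr i hi
    · have h1 : r (Sum.inr (Sum.inr l)) = 1 := by
        have h2 := congrFun (congrFun hS1 l) l
        change R _ _ = _ at h2
        rw [(hr _).2, Matrix.one_apply_eq, ← map_one (algebraMap ℝ F)] at h2
        exact algebraMap_real_injective h2
      change r (Sum.inr (Sum.inr l)) * r (Sum.inr (Sum.inr l)) = 1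
      rw [h1, one_mul]

theorem wtForm_mul_wtDiag_mul (d : WIdx q p → ℝ) :
    wtForm F q p * (wtDiag F q p d)ᴴ * wtForm F q p = wtDiag F q p (d ∘ flipIdx) := by
  ext i j
  rw [form_conj_apply]
  by_cases h : i = j
  · subst h
    simp only [wtDiag, Matrix.diagonal_apply_eq, star_algebraMap_real, Function.comp_apply]
    rw [← Algebra.commutes, mul_assoc, flipSign_mul_self, mul_one]
  · have h' : flipIdx j ≠ flipIdx i := fun h0 => h (by
      rw [← flipIdx_flipIdx i, ← h0, flipIdx_flipIdx])
    simp [wtDiag, h, h']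

theorem wtDiag_mul_wtDiag (d e : WIdx q p → ℝ) :
    wtDiag F q p d * wtDiag F q p e = wtDiag F q p fun i => d i * e i := by
  simp [wtDiag]

variable [CompleteSpace F]

/-- Iwasawa decomposition of a matrix preserving the Hermitian form. -/
theorem exists_iwasawa (hqp : q ≤ p) {g : Mat F q p}
    (hg : g * (form F q p * gᴴ * form F q p) = 1) :
    ∃ (u : U q F) (v : U p F) (s : Fin q → ℝ), ∃ n ∈ N F q p,
      g = Matrix.fromBlocks (u : Matrix _ _ F) 0 0 (v : Matrix _ _ F) * a F p s * n := by
  have hG : toWt g * (wtForm F q p * (toWt g)ᴴ * wtForm F q p) = 1 := by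
    rw [← toWt_conjTranspose, ← toWt_form hqp, ← toWt_mul hqp, ← toWt_mul hqp, ← toWt_mul hqp, hg,
      toWt_one hqp]
  obtain ⟨V, R, R', hV, hR', hRt, hRt', ⟨r, hr⟩, hVR⟩ :=
    exists_qr (fineLvl_injective hqp) (mul_eq_one_comm.mp hG)
  rw [hVR] at hG
  obtain ⟨h1, h2, h3⟩ := qr_factor_preserves_form hqp hV hR' hRt hRt' hr hG
  have hrpos : ∀ i, 0 < r i := fun i => (hr i).1
  have hVJ : V * (wtForm F q p * Vᴴ * wtForm F q p) = 1 := by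
    rw [form_conj_mul] at hG
    calc V * (wtForm F q p * Vᴴ * wtForm F q p)
        = V * (R * (wtForm F q p * Rᴴ * wtForm F q p)) *
          (wtForm F q p * Vᴴ * wtForm F q p) := by rw [h1, Matrix.mul_one]
      _ = 1 := by rw [← hG]; simp only [Matrix.mul_assoc]
  set k := ofWt V with hk
  have hkk : kᴴ * k = 1 := by
    rw [hk, ← ofWt_conjTranspose, ← ofWt_mul hqp, hV, ofWt_one hqp]
  -- The matrix `k` is unitary and preserves the form, so it commutes with the form and is block
  -- diagonal.
  have hkJ : form F q p * k = k * form F q p := by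
    have h4 : k * (form F q p * kᴴ * form F q p) = 1 := by
      rw [hk, ← ofWt_conjTranspose, ← ofWt_wtForm hqp, ← ofWt_mul hqp, ← ofWt_mul hqp,
        ← ofWt_mul hqp, hVJ, ofWt_one hqp]
    have h5 : form F q p * form F q p = 1 := by
      simp [form, Matrix.fromBlocks_multiply]
    calc form F q p * k = k * (form F q p * kᴴ * form F q p) * (form F q p * k) := by
          rw [h4, Matrix.one_mul]
      _ = k * (form F q p * kᴴ * (form F q p * form F q p) * k) := by simp only [Matrix.mul_assoc]
      _ = k * (form F q p * (kᴴ * k)) := by rw [h5, Matrix.mul_one]; simp only [Matrix.mul_assoc]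
      _ = _ := by rw [hkk, Matrix.mul_one]
  have hoff : k.toBlocks₁₂ = 0 ∧ k.toBlocks₂₁ = 0 := by
    rw [← Matrix.fromBlocks_toBlocks k] at hkJ
    simp only [form, Matrix.fromBlocks_multiply, Matrix.one_mul, Matrix.mul_one, Matrix.mul_zero,
      Matrix.zero_mul, add_zero, zero_add, Matrix.neg_mul, Matrix.mul_neg] at hkJ
    obtain ⟨-, h5, h6, -⟩ := Matrix.fromBlocks_inj.mp hkJ
    have hchar : CharZero F := charZero_of_injective_algebraMap (algebraMap ℝ F).injective
    constructor
    · ext i j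
      exact self_eq_neg.mp (congrFun (congrFun h5 i) j)
    · ext i j
      exact neg_eq_self.mp (congrFun (congrFun h6 i) j)
  have hkb : k = Matrix.fromBlocks k.toBlocks₁₁ 0 0 k.toBlocks₂₂ := by
    conv_lhs => rw [← Matrix.fromBlocks_toBlocks k, hoff.1, hoff.2]
  rw [hkb, Matrix.fromBlocks_conjTranspose, Matrix.fromBlocks_multiply, ← Matrix.fromBlocks_one]
    at hkk
  obtain ⟨hu, -, -, hv⟩ := Matrix.fromBlocks_inj.mp hkk
  simp only [Matrix.conjTranspose_zero, Matrix.mul_zero, add_zero, zero_add] at hu hv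
  -- The diagonal of `R` is `exp` of the weights at `s = log r`, because opposite weights have
  -- inverse entries and zero weights have entry `1`. Dividing it off leaves the unipotent factor.
  refine ⟨⟨k.toBlocks₁₁, Unitary.mem_iff.mpr ⟨hu, mul_eq_one_comm.mp hu⟩⟩,
    ⟨k.toBlocks₂₂, Unitary.mem_iff.mpr ⟨hv, mul_eq_one_comm.mp hv⟩⟩,
    fun i => Real.log (r (Sum.inl i)), ofWt (wtDiag F q p r⁻¹ * R), ofWt_mem_N hqp ?_ ?_, ?_⟩
  · intro i j hij
    rw [Matrix.sub_apply, wtDiag_mul_apply, Pi.inv_apply]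
    rcases lt_or_eq_of_le hij with h | h
    · rw [hRt i j (fineLvl_lt hqp h), Matrix.one_apply_ne (fun h0 => by simp [h0] at h)]
      simp
    · rcases lvl_eq h.symm with rfl | ⟨l, l', rfl, rfl⟩
      · rw [(hr i).2, Matrix.one_apply_eq, Algebra.smul_def, ← map_mul,
          inv_mul_cancel₀ (hrpos i).ne', map_one, sub_self]
      · rw [h2]
        by_cases hl : l = l'
        · subst hl
          have h5 := h2 l l
          rw [(hr _).2, Matrix.one_apply_eq, ← map_one (algebraMap ℝ F)] at h5
          rw [algebraMap_real_injective h5]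
          simp
        · simp [hl]
  · rw [form_conj_mul, wtForm_mul_wtDiag_mul]
    calc wtDiag F q p r⁻¹ * R * (wtForm F q p * Rᴴ * wtForm F q p * wtDiag F q p (r⁻¹ ∘ flipIdx))
        = wtDiag F q p r⁻¹ * (R * (wtForm F q p * Rᴴ * wtForm F q p)) *
          wtDiag F q p (r⁻¹ ∘ flipIdx) := by simp only [Matrix.mul_assoc]
      _ = 1 := by
        rw [h1, Matrix.mul_one, wtDiag_mul_wtDiag]
        simp [wtDiag, ← mul_inv, h3]
  · have ha : a F p (fun i => Real.log (r (Sum.inl i))) = ofWt (wtDiag F q p r) := by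
      rw [← ofWt_toWt hqp (a F p _), toWt_a hqp]
      congr 2
      ext i
      rcases i with i | i | l
      · simp [wt, Real.exp_log (hrpos _)]
      · have := h3 (Sum.inl i)
        simp only [flipIdx, Sum.elim_inl] at this
        simp only [wt, Sum.elim_inr, Sum.elim_inl, Real.exp_neg, Real.exp_log (hrpos _)]
        exact inv_eq_of_mul_eq_one_right this
      · have h5 := h2 l l
        rw [(hr _).2, Matrix.one_apply_eq, ← map_one (algebraMap ℝ F)] at h5
        rw [algebraMap_real_injective h5]
        simp [wt]
    rw [← ofWt_toWt hqp g, hVR]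
    simp only [← hkb]
    rw [ha, hk, ← ofWt_mul hqp, ← ofWt_mul hqp, Matrix.mul_assoc V,
      ← Matrix.mul_assoc (wtDiag F q p r), wtDiag_mul_wtDiag]
    have : (wtDiag F q p fun i => r i * r⁻¹ i) = 1 := by
      simp [wtDiag, mul_inv_cancel₀ (hrpos _).ne']
    rw [this, Matrix.one_mul]

theorem a_mul_preserves_form (hqp : q ≤ p) (t : Fin q → ℝ) (k : K F q p) :
    (a F p t * k.toMat) * (form F q p * (a F p t * k.toMat)ᴴ * form F q p) = 1 := by
  have hk : k.toMat * (form F q p * k.toMatᴴ * form F q p) = 1 := by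
    have h1 := Unitary.mul_star_self_of_mem k.1.1.2
    have h2 := Unitary.mul_star_self_of_mem k.1.2.2
    rw [Matrix.star_eq_conjTranspose] at h1 h2
    simp [K.toMat, form, Matrix.fromBlocks_multiply, Matrix.fromBlocks_conjTranspose, h1, h2]
  have ha : a F p t * (form F q p * (a F p t)ᴴ * form F q p) = 1 := by
    rw [← ofWt_toWt hqp (a F p t), toWt_a hqp, ← ofWt_wtForm hqp, ← ofWt_conjTranspose,
      ← ofWt_mul hqp, ← ofWt_mul hqp, ← ofWt_mul hqp, wtForm_mul_wtDiag_mul, wtDiag_mul_wtDiag]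
    have : (wtDiag F q p fun i => Real.exp (wt t i) *
        ((fun a => Real.exp (wt t a)) ∘ flipIdx) i) = 1 := by
      simp [wtDiag, wt_flipIdx, ← Real.exp_add]
    rw [this, ofWt_one hqp]
  have hJ : form F q p * form F q p = 1 := by
    simp [form, Matrix.fromBlocks_multiply]
  calc (a F p t * k.toMat) * (form F q p * (a F p t * k.toMat)ᴴ * form F q p)
      = a F p t * (k.toMat * (form F q p * (k.toMat)ᴴ * (1 * ((a F p t)ᴴ * form F q p)))) := by
        rw [Matrix.conjTranspose_mul]; simp only [Matrix.mul_assoc, Matrix.one_mul]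
    _ = a F p t * ((k.toMat * (form F q p * (k.toMat)ᴴ * form F q p)) *
        (form F q p * (a F p t)ᴴ * form F q p)) := by
        rw [← hJ]; simp only [Matrix.mul_assoc]
    _ = 1 := by rw [hk, Matrix.one_mul, ha]

end Iwasawa

/-! ### The Iwasawa projection read off from `x_t(k)`. -/

/-- A unipotent upper triangular matrix. -/
def IsUnipotentUpper {R : Type} [Ring R] {n : ℕ} (T : Matrix (Fin n) (Fin n) R) : Prop :=
  StrictUpper (fun i : Fin n => (i : ℤ)) (T - 1)

section IwasawaProjection

variable {F : Type} [NormedDivisionRing F] [NormedAlgebra ℝ F] [StarRing F] [StarModule ℝ F]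
variable [Scalars F] {q p : ℕ}

theorem IsUnipotentUpper.apply_eq_zero {R : Type} [Ring R] {n : ℕ} {T : Matrix (Fin n) (Fin n) R}
    (hT : IsUnipotentUpper T) {i j : Fin n} (h : j < i) : T i j = 0 := by
  have := hT i j (Int.ofNat_le.mpr (Fin.le_def.mp h.le))
  rwa [Matrix.sub_apply, Matrix.one_apply_ne h.ne', sub_zero] at this

theorem IsUnipotentUpper.submatrix {R : Type} [Ring R] {m n : ℕ} {T : Matrix (Fin n) (Fin n) R}
    (hT : IsUnipotentUpper T) (h : m ≤ n) :
    IsUnipotentUpper (T.submatrix (Fin.castLE h) (Fin.castLE h)) := by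
  intro i j hij
  have := hT (Fin.castLE h i) (Fin.castLE h j) (by simpa using hij)
  rw [Matrix.sub_apply] at this ⊢
  rw [Matrix.submatrix_apply, ← this]
  simp [Matrix.one_apply]

theorem IsUnipotentUpper.isUnit {R : Type} [Ring R] {n : ℕ} {T : Matrix (Fin n) (Fin n) R}
    (hT : IsUnipotentUpper T) : IsUnit T := by
  have := (StrictUpper.isNilpotent hT).isUnit_one_add
  rwa [add_sub_cancel] at this

/-- As `T` is upper triangular, its first `m` columns vanish below row `m`, so the leading block of
the product involves leading blocks only. -/
theorem conj_diag_mul_submatrix {m n : ℕ} {T : Matrix (Fin n) (Fin n) F} (hT : IsUnipotentUpper T)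
    (d : Fin n → ℝ) (h : m ≤ n) :
    (Tᴴ * diagReal F d * T).submatrix (Fin.castLE h) (Fin.castLE h) =
      (T.submatrix (Fin.castLE h) (Fin.castLE h))ᴴ * diagReal F (d ∘ Fin.castLE h) *
        T.submatrix (Fin.castLE h) (Fin.castLE h) := by
  ext i j
  rw [Matrix.submatrix_apply, Matrix.mul_apply, Matrix.mul_apply]
  symm
  refine Fintype.sum_of_injective (Fin.castLE h) (Fin.castLE_injective h) _ _ (fun k hk => ?_)
    fun k => ?_
  · have : Fin.castLE h j < k := by
      by_contra hlt
      apply hk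
      rw [not_lt, Fin.le_def] at hlt
      exact ⟨⟨k, lt_of_le_of_lt hlt j.isLt⟩, rfl⟩
    rw [hT.apply_eq_zero this, mul_zero]
  · simp [diagReal, Matrix.mul_diagonal]

theorem a_toRows₁ [CompleteSpace F] (hqp : q ≤ p) (t : Fin q → ℝ) :
    (a F p t).toRows₁ = Matrix.fromCols (diagReal F fun i => Real.cosh (t i))
      ((diagReal F fun i => Real.sinh (t i)) * (sigma0 F q p)ᴴ) := by
  have h : (wtDiag F q p fun b => Real.exp (wt t b)) =
      Matrix.fromBlocks (diagReal F fun i => Real.exp (t i)) 0 0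
        (Matrix.fromBlocks (diagReal F fun i => Real.exp (-t i)) 0 0 1) := by
    ext (i | i | i) (j | j | j) <;>
      simp [wt, wtDiag, diagReal, Matrix.diagonal_apply, Matrix.one_apply]
  have hc : diagReal F (fun i => Real.cosh (t i)) = (Real.sqrt 2)⁻¹ • (Real.sqrt 2)⁻¹ •
      (diagReal F (fun i => Real.exp (t i)) + diagReal F fun i => Real.exp (-t i)) := by
    rw [smul_smul, ← mul_inv, Real.mul_self_sqrt (by norm_num)]
    ext i j
    by_cases hij : i = j
    · subst hij
      simp [diagReal, Real.cosh_eq, Algebra.smul_def]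
      simp only [← map_add, ← map_mul, ← map_inv₀, ← map_div₀]
      congr 1; ring
    · simp [diagReal, hij]
  have hs : diagReal F (fun i => Real.sinh (t i)) = (Real.sqrt 2)⁻¹ • (Real.sqrt 2)⁻¹ •
      (diagReal F (fun i => Real.exp (t i)) - diagReal F fun i => Real.exp (-t i)) := by
    rw [smul_smul, ← mul_inv, Real.mul_self_sqrt (by norm_num)]
    ext i j
    by_cases hij : i = j
    · subst hij
      simp [diagReal, Real.sinh_eq, Algebra.smul_def]
      simp only [← map_sub, ← map_mul, ← map_inv₀, ← map_div₀]
      congr 1; ring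
    · simp [diagReal, hij]
  rw [← ofWt_toWt hqp (a F p t), toWt_a hqp, h, hc, hs, ofWt, wtBasis]
  simp only [Matrix.conjTranspose_fromCols_eq_fromRows_conjTranspose,
    Matrix.conjTranspose_fromRows_eq_fromCols_conjTranspose, Matrix.mul_fromCols,
    Matrix.fromCols_mul_fromBlocks, Matrix.fromRows_mul, Matrix.fromCols_mul_fromRows,
    Matrix.one_mul, Matrix.mul_one, Matrix.mul_zero, Matrix.zero_mul, add_zero, zero_add,
    Matrix.neg_mul, Matrix.mul_neg, Matrix.mul_smul, Matrix.smul_mul,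
    Matrix.conjTranspose_smul, Matrix.conjTranspose_neg, Matrix.conjTranspose_one, star_trivial,
    Matrix.conjTranspose_zero, smul_add, smul_sub, Matrix.sub_mul]
  ext i (j | j) <;> simp [Matrix.toRows₁_apply, sub_eq_add_neg]

/-- If `a_t k = k' a_s n` in the Iwasawa decomposition, then
`cosh t · u + sinh t · σ₀* v σ₀ = u' diag(e^s) T` with a unipotent upper triangular matrix `T`. -/
theorem exists_y_eq [CompleteSpace F] (hqp : q ≤ p) {t s : Fin q → ℝ} {k : K F q p}
    {u : Matrix (Fin q) (Fin q) F} {v : Matrix (Fin p) (Fin p) F} {n : Mat F q p} (hn : n ∈ N F q p)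
    (h : a F p t * k.toMat = Matrix.fromBlocks u 0 0 v * a F p s * n) :
    ∃ T : Matrix (Fin q) (Fin q) F, IsUnipotentUpper T ∧
      y t k = u * diagReal F (fun i => Real.exp (s i)) * T := by
  have hN := strictUpper_of_mem_N hqp hn
  set M := wtDiag F q p (fun b => Real.exp (wt s b)) * toWt n with hM
  set T : Matrix (Fin q) (Fin q) F := fun i j => toWt n (Sum.inl i) (Sum.inl j) with hT
  -- All other weights lie strictly below `f₁, …, f_q`, so a unipotent triangular matrix maps the
  -- span of the first `q` weight vectors to itself.
  have hMC : M.toCols₁ = Matrix.fromRows (diagReal F (fun i => Real.exp (s i)) * T) 0 := by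
    ext (i | i) j
    · rw [Matrix.toCols₁_apply, hM, Matrix.fromRows_apply_inl, wtDiag, diagReal,
        Matrix.diagonal_mul, Matrix.diagonal_mul]
      rfl
    · have hlt : lvl (Sum.inl j : WIdx q p) < lvl (Sum.inr i) := by
        rcases i with i | i <;> simp [lvl]
        have := i.isLt; have := j.isLt; omega
      have h0 := hN (Sum.inr i) (Sum.inl j) hlt.le
      rw [Matrix.sub_apply, Matrix.one_apply_ne (by simp), sub_zero] at h0
      rw [Matrix.toCols₁_apply, hM, wtDiag_mul_apply, h0]
      simp
  have h1 : a F p t * k.toMat * wtBasis F q p =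
      Matrix.fromBlocks u 0 0 v * (wtBasis F q p * M) := by
    rw [h, hM, ← toWt_a hqp, toWt, toWt]
    simp only [Matrix.mul_assoc, wtBasis_mul_conj_mul hqp]
  -- Restricting to the first `q` rows removes `v'`. Both sides then carry the factor `1/√2` of the
  -- weight basis, which is cancelled below.
  have h2 := congrArg (fun X => (Matrix.toCols₁ X).toRows₁) h1
  have hL : (a F p t * k.toMat * wtBasis F q p).toCols₁.toRows₁ =
      (a F p t).toRows₁ * (k.toMat * (wtBasis F q p).toCols₁) := by
    rw [Matrix.mul_assoc]; rfl
  have hR : (Matrix.fromBlocks u 0 0 v * (wtBasis F q p * M)).toCols₁.toRows₁ =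
      (Matrix.fromBlocks u 0 0 v).toRows₁ * (wtBasis F q p * M.toCols₁) := rfl
  have hu : (Matrix.fromBlocks u 0 0 v).toRows₁ =
      Matrix.fromCols u (0 : Matrix (Fin q) (Fin p) F) := by
    ext i (j | j) <;> rfl
  rw [hL, hR, hMC, a_toRows₁ hqp, hu, wtBasis, K.toMat, Matrix.toCols₁_fromCols,
    Matrix.fromBlocks_mul_fromRows, Matrix.fromCols_mul_fromRows, Matrix.fromCols_mul_fromRows,
    Matrix.fromRows_mul, Matrix.mul_zero, add_zero, Matrix.fromCols_mul_fromRows] at h2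
  simp only [Matrix.mul_smul, Matrix.smul_mul, Matrix.zero_mul, Matrix.mul_one, Matrix.one_mul,
    add_zero, zero_add, ← smul_add] at h2
  have hinj := smul_right_injective (Matrix (Fin q) (Fin q) F)
    (show (Real.sqrt 2)⁻¹ ≠ 0 by positivity)
  refine ⟨T, ?_, ?_⟩
  · intro i j hij
    have := hN (Sum.inl i) (Sum.inl j) (by simpa [lvl] using hij)
    rw [Matrix.sub_apply] at this ⊢
    simpa [hT, Matrix.one_apply] using this
  · rw [Matrix.mul_assoc u, ← hinj h2, y]
    simp only [Matrix.mul_assoc]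

theorem x_eq {t s : Fin q → ℝ} {k : K F q p} {u : U q F}
    {T : Matrix (Fin q) (Fin q) F}
    (h : y t k = (u : Matrix _ _ F) * diagReal F (fun i => Real.exp (s i)) * T) :
    x t k = Tᴴ * diagReal F (fun i => Real.exp (2 * s i)) * T := by
  have hu := Unitary.star_mul_self_of_mem u.2
  rw [Matrix.star_eq_conjTranspose] at hu
  have hd : (diagReal F (fun i => Real.exp (s i)))ᴴ * diagReal F (fun i => Real.exp (s i)) =
      diagReal F (fun i => Real.exp (2 * s i)) := by
    rw [diagReal, Matrix.diagonal_conjTranspose, Matrix.diagonal_mul_diagonal, diagReal]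
    congr 1
    ext i
    rw [Pi.star_apply, star_algebraMap_real, ← map_mul, ← Real.exp_add, two_mul]
  rw [x, h, Matrix.conjTranspose_mul, Matrix.conjTranspose_mul, ← hd]
  calc Tᴴ * ((diagReal F fun i => Real.exp (s i))ᴴ * (u : Matrix _ _ F)ᴴ) *
        ((u : Matrix _ _ F) * (diagReal F fun i => Real.exp (s i)) * T)
      = Tᴴ * (diagReal F fun i => Real.exp (s i))ᴴ * ((u : Matrix _ _ F)ᴴ * (u : Matrix _ _ F)) *
        (diagReal F fun i => Real.exp (s i)) * T := by simp only [Matrix.mul_assoc]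
    _ = _ := by rw [hu, Matrix.mul_one]; simp only [Matrix.mul_assoc]

theorem isUnit_y {t s : Fin q → ℝ} {k : K F q p} {u : U q F}
    {T : Matrix (Fin q) (Fin q) F} (hT : IsUnipotentUpper T)
    (h : y t k = (u : Matrix _ _ F) * diagReal F (fun i => Real.exp (s i)) * T) :
    IsUnit (y t k) := by
  rw [h]
  refine (IsUnit.mul (Unitary.toUnits u).isUnit ?_).mul hT.isUnit
  refine IsUnit.of_mul_eq_one (diagReal F fun i => Real.exp (-s i)) ?_
  rw [diagReal, diagReal, Matrix.diagonal_mul_diagonal]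
  simp [← map_mul, ← Real.exp_add]

end IwasawaProjection


/-- This uses the decomposition with merely unitary `u`, `v`, so it is available for the proof that
these lie in `K`. -/
theorem isUnit_cosh_mul_add_sinh_mul {F : Type} [NormedDivisionRing F] [NormedAlgebra ℝ F]
    [StarRing F] [StarModule ℝ F] [Scalars F] [LawfulScalars F] [CompleteSpace F] {q p : ℕ}
    (hqp : q ≤ p) (t : Fin q → ℝ) (k : K F q p) : IsUnit (y t k) := by
  obtain ⟨u, v, s, n, hn, h⟩ := exists_iwasawa hqp (a_mul_preserves_form hqp t k)
  obtain ⟨T, hT, hy⟩ := exists_y_eq hqp hn h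
  exact isUnit_y hT hy

/-- The laws of the determinant and of the group `K`. -/
class LawfulDet (F : Type) [NormedDivisionRing F] [NormedAlgebra ℝ F] [StarRing F]
    [StarModule ℝ F] [Scalars F] : Prop extends LawfulScalars F where
  det_conj : ∀ {n : ℕ} (T : Matrix (Fin n) (Fin n) F) (d : Fin n → ℝ), IsUnipotentUpper T →
    (∀ i, 0 < d i) → Scalars.det (Tᴴ * diagReal F d * T) = ((∏ i, d i : ℝ) : ℂ)
  -- Continuity is asked only on positive definite matrices: the Dieudonné determinant is a complex
  -- square root, which is discontinuous across its branch cut.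
  continuous_det : ∀ {X : Type} [TopologicalSpace X] {n : ℕ} (A : X → Matrix (Fin n) (Fin n) F),
    Continuous A → (∀ z, ∃ (T : Matrix (Fin n) (Fin n) F) (d : Fin n → ℝ), IsUnipotentUpper T ∧
      (∀ i, 0 < d i) ∧ A z = Tᴴ * diagReal F d * T) → Continuous fun z => Scalars.det (A z)
  mem_K : ∀ {q p : ℕ} (_ : q ≤ p) (t s : Fin q → ℝ) (k : K F q p) (u : U q F) (v : U p F),
    ∀ n ∈ N F q p, a F p t * k.toMat =
      Matrix.fromBlocks (u : Matrix _ _ F) 0 0 (v : Matrix _ _ F) * a F p s * n →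
    (u, v) ∈ Scalars.K (F := F) q p

/-! ### Summation by parts. -/

section Summation

theorem sum_range_partialSum_mul (s M : ℕ → ℂ) (n : ℕ) :
    ∑ r ∈ Finset.range n, (∑ i ∈ Finset.range (r + 1), s i) * (M r - M (r + 1)) =
      ∑ r ∈ Finset.range n, M r * s r - (∑ i ∈ Finset.range n, s i) * M n := by
  induction n with
  | zero => simp
  | succ n ih =>
    rw [Finset.sum_range_succ, ih, Finset.sum_range_succ, Finset.sum_range_succ]
    ring

/-- Summation by parts. -/
theorem sum_partialSum_mul {q : ℕ} (s mu : Fin q → ℂ) :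
    ∑ r : Fin q, (∑ i : Fin (r.val + 1), s (Fin.castLE r.isLt i)) *
      (mu r - if h : r.val + 1 < q then mu ⟨r.val + 1, h⟩ else 0) = ∑ r, mu r * s r := by
  let s' : ℕ → ℂ := fun i => if h : i < q then s ⟨i, h⟩ else 0
  let M : ℕ → ℂ := fun i => if h : i < q then mu ⟨i, h⟩ else 0
  have h := sum_range_partialSum_mul s' M q
  -- The convention `μ_{q+1} = 0` kills the boundary term.
  have hM : M q = 0 := by simp [M]
  rw [hM, mul_zero, sub_zero, Finset.sum_range, Finset.sum_range] at h
  convert h using 2 with r _ r _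
  · congr 1
    · rw [Finset.sum_range]
      refine Finset.sum_congr rfl fun i _ => ?_
      have : i.val < q := lt_of_lt_of_le i.isLt r.isLt
      simp only [s', this, dite_true]
      rfl
    · simp [M]
  · simp [M, s']

theorem eq_of_partialSum_eq {q : ℕ} {s s' : Fin q → ℝ}
    (h : ∀ r : Fin q, ∑ i : Fin (r.val + 1), s (Fin.castLE r.isLt i) =
      ∑ i : Fin (r.val + 1), s' (Fin.castLE r.isLt i)) : s = s' := by
  have key : ∀ (n : ℕ) (hn : n < q), s ⟨n, hn⟩ = s' ⟨n, hn⟩ := by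
    intro n
    induction n using Nat.strong_induction_on with
    | _ n ih =>
      intro hn
      have h1 := h ⟨n, hn⟩
      rw [Fin.sum_univ_castSucc, Fin.sum_univ_castSucc] at h1
      have h2 : ∑ i : Fin n, s (Fin.castLE hn i.castSucc) =
          ∑ i : Fin n, s' (Fin.castLE hn i.castSucc) :=
        Finset.sum_congr rfl fun i _ => ih i i.isLt _
      rw [h2] at h1
      exact add_left_cancel h1
  ext ⟨i, hi⟩
  exact key i hi

end Summation

/-! ### Equality of the integrands and integrability, for any lawful scalars. -/

section Main

variable {F : Type} [NormedDivisionRing F] [NormedAlgebra ℝ F] [StarRing F] [StarModule ℝ F]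
variable [Scalars F] [LawfulDet F] {q p : ℕ}

theorem minor_eq {s : Fin q → ℝ} {T : Matrix (Fin q) (Fin q) F} (hT : IsUnipotentUpper T)
    (r : Fin q) : minor (Tᴴ * diagReal F (fun i => Real.exp (2 * s i)) * T) r =
      ((Real.exp (2 * ∑ i : Fin (r.val + 1), s (Fin.castLE r.isLt i)) : ℝ) : ℂ) := by
  rw [minor, conj_diag_mul_submatrix hT, LawfulDet.det_conj _
    ((fun i => Real.exp (2 * s i)) ∘ Fin.castLE r.isLt) (hT.submatrix _)
    (fun i => Real.exp_pos _), Finset.mul_sum, Real.exp_sum]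
  rfl

theorem powerFun_eq {s : Fin q → ℝ} {T : Matrix (Fin q) (Fin q) F} (hT : IsUnipotentUpper T)
    (mu : Fin q → ℂ) : powerFun mu (Tᴴ * diagReal F (fun i => Real.exp (2 * s i)) * T) =
      Complex.exp (∑ r, 2 * mu r * s r) := by
  have h := sum_partialSum_mul (fun i => ((2 * s i : ℝ) : ℂ)) mu
  have h' : ∑ r, 2 * mu r * (s r : ℂ) = ∑ r, mu r * ((2 * s r : ℝ) : ℂ) :=
    Finset.sum_congr rfl fun r _ => by push_cast; ring
  rw [h', ← h, Complex.exp_sum, powerFun]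
  refine Finset.prod_congr rfl fun r _ => ?_
  -- The minor is a positive real number, so the principal branch of its logarithm is the real
  -- exponent.
  rw [minor_eq hT, Complex.cpow_def_of_ne_zero (by
    exact_mod_cast (Real.exp_pos _).ne'), ← Complex.ofReal_log (Real.exp_pos _).le, Real.log_exp,
    Finset.mul_sum, Complex.ofReal_sum]

variable [CompleteSpace F]

theorem exists_isAbelianPart (hqp : q ≤ p) (t : Fin q → ℝ) (k : K F q p) :
    ∃ s, IsAbelianPart (a F p t * k.toMat) s := by
  obtain ⟨u, v, s, n, hn, h⟩ := exists_iwasawa hqp (a_mul_preserves_form hqp t k)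
  exact ⟨s, ⟨(u, v), LawfulDet.mem_K hqp t s k u v n hn h⟩, n, hn, h⟩

theorem exists_y_eq_of_isAbelianPart (hqp : q ≤ p) {t s : Fin q → ℝ} {k : K F q p}
    (h : IsAbelianPart (a F p t * k.toMat) s) :
    ∃ (u : U q F) (T : Matrix (Fin q) (Fin q) F), IsUnipotentUpper T ∧
      y t k = (u : Matrix _ _ F) * diagReal F (fun i => Real.exp (s i)) * T := by
  obtain ⟨k', n, hn, h⟩ := h
  obtain ⟨T, hT, hy⟩ := exists_y_eq hqp hn h
  exact ⟨k'.1.1, T, hT, hy⟩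

/-- The minors of `x_t(k)` do not depend on the chosen decomposition and determine the partial sums
`s₁ + … + s_r`, hence `s`. -/
theorem existsUnique_isAbelianPart (hqp : q ≤ p) (t : Fin q → ℝ) (k : K F q p) :
    ∃! s, IsAbelianPart (a F p t * k.toMat) s := by
  obtain ⟨s, hs⟩ := exists_isAbelianPart hqp t k
  refine ⟨s, hs, fun s' hs' => eq_of_partialSum_eq fun r => ?_⟩
  obtain ⟨u, T, hT, h⟩ := exists_y_eq_of_isAbelianPart hqp hs
  obtain ⟨u', T', hT', h'⟩ := exists_y_eq_of_isAbelianPart hqp hs'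
  have h1 := minor_eq (s := s) hT r
  have h2 := minor_eq (s := s') hT' r
  rw [← x_eq h] at h1
  rw [← x_eq h', h1] at h2
  have h3 := Real.exp_injective (Complex.ofReal_injective h2)
  linarith

theorem x_mem_Omega (hqp : q ≤ p) (t : Fin q → ℝ) (k : K F q p) : x t k ∈ Omega F q := by
  obtain ⟨Z, hZ⟩ := (isUnit_cosh_mul_add_sinh_mul hqp t k).exists_left_inv
  exact conjTranspose_mul_self_mem_Omega hZ

theorem hcIntegrand_eq (hqp : q ≤ p) (lam : Fin q → ℂ) (t : Fin q → ℝ) (k : K F q p) :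
    hcIntegrand F lam (a F p t) k =
      powerFun (fun r => (Complex.I * lam r - (rhoBC F q p r : ℂ)) / 2) (x t k) := by
  have hs : IsAbelianPart (a F p t * k.toMat) (iwasawaH (a F p t * k.toMat)) :=
    Classical.epsilon_spec (exists_isAbelianPart hqp t k)
  obtain ⟨u, T, hT, h⟩ := exists_y_eq_of_isAbelianPart hqp hs
  rw [x_eq h, powerFun_eq hT, hcIntegrand]
  congr 1
  refine Finset.sum_congr rfl fun r _ => ?_
  ring

variable [ContinuousStar F]

theorem continuous_x (t : Fin q → ℝ) : Continuous fun k : K F q p => x t k := by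
  have h1 : Continuous fun k : K F q p => (k.1.1 : Matrix (Fin q) (Fin q) F) := by fun_prop
  have h2 : Continuous fun k : K F q p => (k.1.2 : Matrix (Fin p) (Fin p) F) := by fun_prop
  unfold x y
  fun_prop

/-- The factorization `T* diag(e^{2s}) T` makes every minor positive, which keeps the complex powers
off the branch cut. -/
theorem continuous_powerFun_x (hqp : q ≤ p) (t : Fin q → ℝ) (mu : Fin q → ℂ) :
    Continuous fun k : K F q p => powerFun mu (x t k) := by
  have hx : ∀ k : K F q p, ∃ (s : Fin q → ℝ) (T : Matrix (Fin q) (Fin q) F),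
      IsUnipotentUpper T ∧ x t k = Tᴴ * diagReal F (fun i => Real.exp (2 * s i)) * T := by
    intro k
    obtain ⟨s, hs⟩ := exists_isAbelianPart hqp t k
    obtain ⟨u, T, hT, h⟩ := exists_y_eq_of_isAbelianPart hqp hs
    exact ⟨s, T, hT, x_eq h⟩
  unfold powerFun
  refine continuous_finsetProd _ fun r _ => Continuous.cpow ?_ continuous_const fun k => ?_
  · refine LawfulDet.continuous_det _ ((continuous_x t).matrix_submatrix _ _) fun k => ?_
    obtain ⟨s, T, hT, h⟩ := hx k
    refine ⟨_, (fun i => Real.exp (2 * s i)) ∘ Fin.castLE r.isLt, hT.submatrix r.isLt,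
      fun i => Real.exp_pos _, ?_⟩
    rw [h]
    exact conj_diag_mul_submatrix hT _ r.isLt
  · obtain ⟨s, T, hT, h⟩ := hx k
    rw [h, minor_eq hT]
    exact Complex.ofReal_mem_slitPlane.mpr (Real.exp_pos _)

/-- The integral representation of the spherical functions over a single scalar field. -/
theorem spherical_eq_integral_powerFun (hqp : q ≤ p) (lam : Fin q → ℂ) (t : Fin q → ℝ) :
    (∀ k : K F q p, ∃! s : Fin q → ℝ, IsAbelianPart (a F p t * k.toMat) s) ∧
      (∀ k : K F q p, x t k ∈ Omega F q) ∧
      MeasureTheory.Integrable (hcIntegrand F lam (a F p t)) (haarK F q p) ∧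
      MeasureTheory.Integrable (fun k : K F q p =>
        powerFun (fun r => (Complex.I * lam r - (rhoBC F q p r : ℂ)) / 2) (x t k))
        (haarK F q p) ∧
      spherical F lam (a F p t) =
        ∫ k : K F q p,
          powerFun (fun r => (Complex.I * lam r - (rhoBC F q p r : ℂ)) / 2) (x t k)
          ∂(haarK F q p) := by
  have h1 : hcIntegrand F lam (a F p t) = fun k : K F q p =>
      powerFun (fun r => (Complex.I * lam r - (rhoBC F q p r : ℂ)) / 2) (x t k) :=
    funext fun k => hcIntegrand_eq hqp lam t k
  have h2 : MeasureTheory.Integrable (fun k : K F q p =>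
      powerFun (fun r => (Complex.I * lam r - (rhoBC F q p r : ℂ)) / 2) (x t k))
      (haarK F q p) := by
    have : MeasureTheory.IsFiniteMeasureOnCompacts (haarK F q p) := by
      unfold haarK; infer_instance
    exact (continuous_powerFun_x hqp t _).integrable_of_hasCompactSupport
      (HasCompactSupport.of_compactSpace _)
  refine ⟨existsUnique_isAbelianPart hqp t, x_mem_Omega hqp t, h1 ▸ h2, h2, ?_⟩
  rw [spherical, h1]

end Main

/-! ### Determinants over `ℝ` and `ℂ`. -/

section Commutative

variable {𝕜 : Type} [NormedField 𝕜] [NormedAlgebra ℝ 𝕜] [StarRing 𝕜] [StarModule ℝ 𝕜]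
variable [Scalars 𝕜] {q p : ℕ}

theorem det_toWt (hqp : q ≤ p) (X : Mat 𝕜 q p) : (toWt X).det = X.det := by
  have h1 : (wtBasis 𝕜 q p)ᴴ * wtBasis 𝕜 q p = 1 := wtBasis_conj_mul_self hqp
  have h2 : wtBasis 𝕜 q p * (wtBasis 𝕜 q p)ᴴ = 1 := wtBasis_mul_conj_self hqp
  have h3 : ((wtBasis 𝕜 q p)ᴴ * X * wtBasis 𝕜 q p).det = X.det :=
    Matrix.det_conj_of_mul_eq_one h1 h2
  exact h3

theorem det_of_mem_N (hqp : q ≤ p) {n : Mat 𝕜 q p} (hn : n ∈ N 𝕜 q p) : n.det = 1 := by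
  have h : StrictUpper lvl (toWt n - 1) := strictUpper_of_mem_N hqp hn
  rw [← det_toWt hqp, det_eq_one_of_strictUpper_sub_one h]

theorem det_a [CompleteSpace 𝕜] (hqp : q ≤ p) (t : Fin q → ℝ) : (a 𝕜 p t).det = 1 := by
  rw [← det_toWt hqp, toWt_a hqp, wtDiag, Matrix.det_diagonal, ← map_prod, ← Real.exp_sum, wt_sum,
    Real.exp_zero, map_one]

/-- Both `a_t` and `N` have determinant one, so the product `det u · det v` survives the
decomposition. This is the condition that defines `K` for `ℂ`. -/
theorem det_mul_det_eq [CompleteSpace 𝕜] (hqp : q ≤ p) {t s : Fin q → ℝ} {k : K 𝕜 q p}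
    {u : Matrix (Fin q) (Fin q) 𝕜} {v : Matrix (Fin p) (Fin p) 𝕜} {n : Mat 𝕜 q p}
    (hn : n ∈ N 𝕜 q p) (h : a 𝕜 p t * k.toMat = Matrix.fromBlocks u 0 0 v * a 𝕜 p s * n) :
    u.det * v.det = (k.1.1 : Matrix (Fin q) (Fin q) 𝕜).det *
      (k.1.2 : Matrix (Fin p) (Fin p) 𝕜).det := by
  have h1 := congrArg Matrix.det h
  rw [Matrix.det_mul, Matrix.det_mul, Matrix.det_mul, det_a hqp, det_a hqp, det_of_mem_N hqp hn,
    K.toMat, Matrix.det_fromBlocks_zero₂₁, Matrix.det_fromBlocks_zero₂₁, one_mul, mul_one,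
    mul_one] at h1
  exact h1.symm

theorem det_conj_diagReal {n : ℕ} {T : Matrix (Fin n) (Fin n) 𝕜} (hT : IsUnipotentUpper T)
    (d : Fin n → ℝ) : (Tᴴ * diagReal 𝕜 d * T).det = algebraMap ℝ 𝕜 (∏ i, d i) := by
  rw [Matrix.det_mul, Matrix.det_mul, Matrix.det_conjTranspose,
    det_eq_one_of_strictUpper_sub_one hT, diagReal, Matrix.det_diagonal, map_prod]
  simp

end Commutative

instance : LawfulScalars ℝ where
  star_mul_self_eq a := by simp [sq]
  redTrace_mul_comm a b := by rw [mul_comm]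

instance : LawfulScalars ℂ where
  star_mul_self_eq a := by simpa using Complex.conj_mul' a
  redTrace_mul_comm a b := by rw [mul_comm]

instance : LawfulScalars ℍ[ℝ] where
  star_mul_self_eq a := by
    rw [Quaternion.star_mul_self, Quaternion.normSq_eq_norm_mul_self, sq]
    rfl
  redTrace_mul_comm a b := by
    change (((a * b).re : ℝ) : ℍ[ℝ]) = (((b * a).re : ℝ) : ℍ[ℝ])
    congr 1
    simp only [Quaternion.re_mul]
    ring

/-- Along `τ ↦ τ t` the determinant is continuous and never zero, and at `τ = 0` it is `det u = 1`.
This replaces the connectedness of `SO₀(q,p)`. -/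
theorem det_y_pos {q p : ℕ} (hqp : q ≤ p) (t : Fin q → ℝ) (k : K ℝ q p) : 0 < (y t k).det := by
  have hne : ∀ τ : ℝ, (y (τ • t) k).det ≠ 0 := by
    intro τ
    have hu : IsUnit (y (τ • t) k) := isUnit_cosh_mul_add_sinh_mul hqp (τ • t) k
    exact ((Matrix.isUnit_iff_isUnit_det _).mp hu).ne_zero
  have hcont : Continuous fun τ : ℝ => (y (τ • t) k).det := by
    have hd : ∀ f : ℝ → ℝ, Continuous f →
        Continuous fun τ : ℝ => diagReal ℝ fun i => f ((τ • t) i) := fun f hf =>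
      (continuous_pi fun i => hf.comp (continuous_id.smul continuous_const)).matrix_diagonal
    have hy : Continuous fun τ : ℝ => y (τ • t) k :=
      ((hd _ Real.continuous_cosh).matrix_mul continuous_const).add
        ((hd _ Real.continuous_sinh).matrix_mul continuous_const)
    exact hy.matrix_det
  have h0 : (y ((0 : ℝ) • t) k).det = 1 := by
    have : y ((0 : ℝ) • t) k = (k.1.1 : Matrix (Fin q) (Fin q) ℝ) := by
      simp [y, diagReal]
    rw [this]
    exact k.2.1
  by_contra hneg
  obtain ⟨τ, -, hτ⟩ := intermediate_value_Icc' (zero_le_one' ℝ) hcont.continuousOn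
    (show (0 : ℝ) ∈ Set.Icc _ _ from ⟨by simpa using hneg, by simp only [h0]; norm_num⟩)
  exact hne τ hτ

instance : LawfulDet ℝ where
  det_conj T d hT _ := by
    change ((Tᴴ * diagReal ℝ d * T).det : ℂ) = _
    rw [det_conj_diagReal hT]
    rfl
  continuous_det A hA _ := Complex.continuous_ofReal.comp hA.matrix_det
  mem_K {q p} hqp t s k u v n hn h := by
    have h1 := det_mul_det_eq hqp hn h
    have h2 : (k.1.1 : Matrix (Fin q) (Fin q) ℝ).det = 1 := k.2.1
    have h3 : (k.1.2 : Matrix (Fin p) (Fin p) ℝ).det = 1 := k.2.2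
    rw [h2, h3, mul_one] at h1
    obtain ⟨T, hT, hy⟩ := exists_y_eq hqp hn h
    -- An orthogonal `u` has determinant `±1`. Positivity of `det y = det u · ∏ e^{s_i}` selects
    -- `+1`, and then `det v = 1` follows.
    have h4 := det_y_pos hqp t k
    rw [hy, Matrix.det_mul, Matrix.det_mul, det_eq_one_of_strictUpper_sub_one hT, mul_one, diagReal,
      Matrix.det_diagonal] at h4
    have h5 : (0 : ℝ) < ∏ i, algebraMap ℝ ℝ (Real.exp (s i)) :=
      Finset.prod_pos fun i _ => Real.exp_pos _
    have h6 := (pos_iff_pos_of_mul_pos h4).mpr h5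
    have h7 := congrArg Matrix.det (Unitary.star_mul_self_of_mem u.2)
    rw [Matrix.det_mul, Matrix.star_eq_conjTranspose, Matrix.det_conjTranspose, Matrix.det_one,
      star_trivial] at h7
    have h8 : (u : Matrix (Fin q) (Fin q) ℝ).det = 1 := by nlinarith
    rw [h8, one_mul] at h1
    exact ⟨h8, h1⟩

instance : LawfulDet ℂ where
  det_conj T d hT _ := det_conj_diagReal hT d
  continuous_det A hA _ := hA.matrix_det
  mem_K {q p} hqp t s k u v n hn h := by
    have h1 := det_mul_det_eq hqp hn h
    have h2 : (k.1.1 : Matrix (Fin q) (Fin q) ℂ).det * (k.1.2 : Matrix (Fin p) (Fin p) ℂ).det = 1 :=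
      k.2
    exact h1.trans h2

/-! ### The Dieudonné determinant over `ℍ`. -/

section Quaternionic

/-- The first complex component of a quaternion. -/
def quatFst : ℍ[ℝ] →+ ℂ where
  toFun a := ⟨a.re, a.imI⟩
  map_zero' := rfl
  map_add' _ _ := rfl

/-- The second complex component of a quaternion. -/
def quatSnd : ℍ[ℝ] →+ ℂ where
  toFun a := ⟨a.imJ, a.imK⟩
  map_zero' := rfl
  map_add' _ _ := rfl

theorem quatFst_apply (a : ℍ[ℝ]) : quatFst a = ⟨a.re, a.imI⟩ := rfl

theorem quatSnd_apply (a : ℍ[ℝ]) : quatSnd a = ⟨a.imJ, a.imK⟩ := rfl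

/-- Writing `a = a₁ + a₂ j`, the rule `j z = conj(z) j` gives this formula and the next one. -/
theorem quatFst_mul (a b : ℍ[ℝ]) : quatFst (a * b) =
    quatFst a * quatFst b + quatSnd a * -(starRingEnd ℂ) (quatSnd b) := by
  apply Complex.ext <;> simp [quatFst_apply, quatSnd_apply] <;> ring

theorem quatSnd_mul (a b : ℍ[ℝ]) : quatSnd (a * b) =
    quatFst a * quatSnd b + quatSnd a * (starRingEnd ℂ) (quatFst b) := by
  apply Complex.ext <;> simp [quatFst_apply, quatSnd_apply] <;> ring

variable {n : Type}

theorem quatToComplex_eq (A : Matrix n n ℍ[ℝ]) : quatToComplex A =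
    Matrix.fromBlocks (Matrix.of fun i j => quatFst (A i j)) (Matrix.of fun i j => quatSnd (A i j))
      (Matrix.of fun i j => -(starRingEnd ℂ) (quatSnd (A i j)))
      (Matrix.of fun i j => (starRingEnd ℂ) (quatFst (A i j))) := rfl

theorem quatToComplex_mul [Fintype n] (A B : Matrix n n ℍ[ℝ]) :
    quatToComplex (A * B) = quatToComplex A * quatToComplex B := by
  rw [quatToComplex_eq, quatToComplex_eq, quatToComplex_eq, Matrix.fromBlocks_multiply]
  congr 1 <;> ext1 i j <;>
    simp only [Matrix.of_apply, Matrix.add_apply, Matrix.mul_apply, map_sum, quatFst_mul,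
      quatSnd_mul, ← Finset.sum_add_distrib, ← Finset.sum_neg_distrib] <;>
    refine Finset.sum_congr rfl fun k _ => ?_ <;> simp <;> ring

theorem quatToComplex_conjTranspose (A : Matrix n n ℍ[ℝ]) :
    quatToComplex Aᴴ = (quatToComplex A)ᴴ := by
  ext (i | i) (j | j) <;> apply Complex.ext <;> simp [quatToComplex]

theorem quatToComplex_diagReal {m : ℕ} (d : Fin m → ℝ) : quatToComplex (diagReal ℍ[ℝ] d) =
    Matrix.diagonal (Sum.elim (fun i => (d i : ℂ)) fun i => (d i : ℂ)) := by
  ext (i | i) (j | j) <;> by_cases h : i = j <;> apply Complex.ext <;>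
    simp [quatToComplex, diagReal, h, Quaternion.algebraMap_def]

theorem det_quatToComplex_of_isUnipotentUpper {m : ℕ} {T : Matrix (Fin m) (Fin m) ℍ[ℝ]}
    (hT : IsUnipotentUpper T) : (quatToComplex T).det = 1 := by
  -- The two complex copies of an index share a level, so the complex matrix is unipotent with
  -- respect to this preorder.
  refine det_eq_one_of_strictUpper_sub_one
    (b := Sum.elim (fun i : Fin m => (i : ℤ)) fun i : Fin m => (i : ℤ)) ?_
  have h1 : ∀ i j : Fin m, j ≤ i → T i j = (1 : Matrix _ _ ℍ[ℝ]) i j := fun i j hij => by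
    rw [← sub_eq_zero, ← Matrix.sub_apply]
    exact hT i j (Int.ofNat_le.mpr hij)
  rintro (i | i) (j | j) hij <;> simp only [Sum.elim_inl, Sum.elim_inr] at hij <;>
    rw [Matrix.sub_apply] <;> have h2 := h1 i j (by exact_mod_cast hij) <;>
    rcases eq_or_ne i j with rfl | h <;> apply Complex.ext <;>
    simp_all [quatToComplex, Matrix.one_apply]

/-- Each real diagonal entry occurs twice in the complex matrix, so the determinant is a positive
square when all `d i > 0`, with root `∏ d i`. -/
theorem det_quatToComplex_conj {m : ℕ} {T : Matrix (Fin m) (Fin m) ℍ[ℝ]}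
    (hT : IsUnipotentUpper T) (d : Fin m → ℝ) :
    (quatToComplex (Tᴴ * diagReal ℍ[ℝ] d * T)).det = (((∏ i, d i) * ∏ i, d i : ℝ) : ℂ) := by
  rw [quatToComplex_mul, quatToComplex_mul, Matrix.det_mul, Matrix.det_mul,
    quatToComplex_conjTranspose, Matrix.det_conjTranspose,
    det_quatToComplex_of_isUnipotentUpper hT, quatToComplex_diagReal, Matrix.det_diagonal,
    Fintype.prod_sum_type]
  simp

theorem continuous_quatToComplex : Continuous (quatToComplex (n := n)) := by
  have h : ∀ f : ℍ[ℝ] → ℝ, Continuous f → ∀ i j : n,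
      Continuous fun A : Matrix n n ℍ[ℝ] => f (A i j) := fun f hf i j =>
    hf.comp (continuous_id.matrix_elem i j)
  have h2 : ∀ f g : ℍ[ℝ] → ℝ, Continuous f → Continuous g → ∀ i j : n,
      Continuous fun A : Matrix n n ℍ[ℝ] => (⟨f (A i j), g (A i j)⟩ : ℂ) := fun f g hf hg i j =>
    Complex.equivRealProdCLM.symm.continuous.comp ((h f hf i j).prodMk (h g hg i j))
  refine continuous_matrix fun i j => ?_
  rcases i with i | i <;> rcases j with j | j
  · exact h2 _ _ Quaternion.continuous_re Quaternion.continuous_imI i j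
  · exact h2 _ _ Quaternion.continuous_imJ Quaternion.continuous_imK i j
  · exact (Complex.continuous_conj.comp
      (h2 _ _ Quaternion.continuous_imJ Quaternion.continuous_imK i j)).neg
  · exact Complex.continuous_conj.comp
      (h2 _ _ Quaternion.continuous_re Quaternion.continuous_imI i j)

instance : LawfulDet ℍ[ℝ] where
  det_conj T d hT hd := by
    change (quatToComplex (Tᴴ * diagReal ℍ[ℝ] d * T)).det ^ (1 / 2 : ℂ) = _
    have hpos : 0 < ∏ i, d i := Finset.prod_pos fun i _ => hd i
    rw [det_quatToComplex_conj hT, show (1 / 2 : ℂ) = ((1 / 2 : ℝ) : ℂ) by push_cast; rfl,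
      ← Complex.ofReal_cpow (mul_pos hpos hpos).le, ← Real.sqrt_eq_rpow,
      Real.sqrt_mul_self hpos.le]
  continuous_det A hA h := by
    refine Continuous.cpow (Continuous.matrix_det (continuous_quatToComplex.comp hA))
      continuous_const fun z => ?_
    obtain ⟨T, d, hT, hd, hz⟩ := h z
    have hpos : 0 < ∏ i, d i := Finset.prod_pos fun i _ => hd i
    rw [hz, det_quatToComplex_conj hT]
    exact Complex.ofReal_mem_slitPlane.mpr (mul_pos hpos hpos)
  mem_K _ _ _ _ _ _ _ _ _ := Subgroup.mem_top _

end Quaternionic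
end Grassmannian
end
open Grassmannian in
theorem theorem2p1 (q p : ℕ) (hq : 0 < q) (hqp : q < p) (lam : Fin q → ℂ) (t : Fin q → ℝ) :
    ((∀ k : K ℝ q p, ∃! s : Fin q → ℝ, IsAbelianPart (a ℝ p t * k.toMat) s) ∧
      (∀ k : K ℝ q p, x t k ∈ Omega ℝ q) ∧
      MeasureTheory.Integrable (hcIntegrand ℝ lam (a ℝ p t)) (haarK ℝ q p) ∧
      MeasureTheory.Integrable (fun k : K ℝ q p =>
        powerFun (fun r => (Complex.I * lam r - (rhoBC ℝ q p r : ℂ)) / 2) (x t k))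
        (haarK ℝ q p) ∧
      spherical ℝ lam (a ℝ p t) =
        ∫ k : K ℝ q p,
          powerFun (fun r => (Complex.I * lam r - (rhoBC ℝ q p r : ℂ)) / 2) (x t k)
          ∂(haarK ℝ q p)) ∧
    ((∀ k : K ℂ q p, ∃! s : Fin q → ℝ, IsAbelianPart (a ℂ p t * k.toMat) s) ∧
      (∀ k : K ℂ q p, x t k ∈ Omega ℂ q) ∧
      MeasureTheory.Integrable (hcIntegrand ℂ lam (a ℂ p t)) (haarK ℂ q p) ∧
      MeasureTheory.Integrable (fun k : K ℂ q p =>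
        powerFun (fun r => (Complex.I * lam r - (rhoBC ℂ q p r : ℂ)) / 2) (x t k))
        (haarK ℂ q p) ∧
      spherical ℂ lam (a ℂ p t) =
        ∫ k : K ℂ q p,
          powerFun (fun r => (Complex.I * lam r - (rhoBC ℂ q p r : ℂ)) / 2) (x t k)
          ∂(haarK ℂ q p)) ∧
    ((∀ k : K ℍ[ℝ] q p, ∃! s : Fin q → ℝ, IsAbelianPart (a ℍ[ℝ] p t * k.toMat) s) ∧
      (∀ k : K ℍ[ℝ] q p, x t k ∈ Omega ℍ[ℝ] q) ∧
      MeasureTheory.Integrable (hcIntegrand ℍ[ℝ] lam (a ℍ[ℝ] p t)) (haarK ℍ[ℝ] q p) ∧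
      MeasureTheory.Integrable (fun k : K ℍ[ℝ] q p =>
        powerFun (fun r => (Complex.I * lam r - (rhoBC ℍ[ℝ] q p r : ℂ)) / 2) (x t k))
        (haarK ℍ[ℝ] q p) ∧
      spherical ℍ[ℝ] lam (a ℍ[ℝ] p t) =
        ∫ k : K ℍ[ℝ] q p,
          powerFun (fun r => (Complex.I * lam r - (rhoBC ℍ[ℝ] q p r : ℂ)) / 2) (x t k)
          ∂(haarK ℍ[ℝ] q p)) :=
  ⟨spherical_eq_integral_powerFun hqp.le lam t, spherical_eq_integral_powerFun hqp.le lam t,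
    spherical_eq_integral_powerFun hqp.le lam t⟩
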